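/- Let $d\ge 1$ and let $\mathbb T^d=\mathbb R^d/(2\pi\mathbb Z)^d$. For $s\in\mathbb R$ let $\|u\|_s^2=\sum_{k\in\mathbb Z^d}(1+|k|^2)^s|\hat u_k|^2$, where $\hat u_k$ are the Fourier coefficients of $u$ on $\mathbb T^d$, normalised by $(2\pi)^{-d}$. For $c>0$ put $\langle\nabla\rangle_c=\sqrt{-\Delta+c^2}$, $\mathcal A_c=c\langle\nabla\rangle_c-c^2$ and $J_c=c\langle\nabla\rangle_c^{-1}$ (Fourier multipliers). Let $\varphi_1(z)=\frac{e^z-1}{z}$ and $\varphi_2(z)=\frac{e^z-\varphi_1(z)}{z}$ (with $\varphi_1(0)=1$, $\varphi_2(0)=\frac12$). For a time $t$, a step $\tau>0$, $l\in\mathbb Z$ and a function $v$ put $$\Psi(t,s,v)=s e^{2ic^2t}\varphi_1(2ic^2s)v^3+3s e^{-2ic^2t}\varphi_1(-2ic^2s)|v|^2\bar v+s e^{-4ic^2t}\varphi_1(-4ic^2s)\bar v^3,$$ $$\Omega_l(v)=\frac1{\tau^2}\int_0^\tau e^{ilc^2s}\,\Psi(t,s,v)\,ds,\qquad \vartheta(v)=\Omega_0(v),$$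 $$\theta(v)=-\tfrac{9}{128}e^{i\frac\tau2\mathcal A_c}(J_c-1)|v|^4v-\tfrac{9}{64}J_ce^{i\frac\tau2\mathcal A_c}\big[|v|^2(J_c-1)|v|^2v\big]+\tfrac{9}{128}J_ce^{i\frac\tau2\mathcal A_c}\big[v^2(J_c-1)|v|^2\bar v\big].$$ Let $\overline\Omega_l(v)$ denote either the complex conjugate of $\Omega_l(v)$ or, as an alternative reading, $\frac1{\tau^2}\int_0^\tau e^{ilc^2s}\,\overline{\Psi(t,s,v)}\,ds$, which is the complex conjugate of $\Omega_{-l}(v)$; one of the two readings is used throughout, and the lemma holds for each of them. Put $$\begin{aligned} I(t,\tau,v)={}&\tau e^{2ic^2t}e^{i\tau\mathcal A_c}\varphi_1\big(i\tau(2c^2-\tfrac12\Delta)\big)v^3\\ &+i\tau^2e^{2ic^2t}e^{i\tau\mathcal A_c}\varphi_2\big(i\tau(2c^2-\tfrac12\Delta)\big)\big[(\tfrac12\Delta-\mathcal A_c)v^3+3v^2\mathcal A_cv\big]\\ &+3\tau e^{-2ic^2t}e^{i\tau\mathcal A_c}\varphi_1\big(i\tau(-2c^2-\mathcal A_c)\big)|v|^2\bar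 v\\ &+3i\tau^2e^{-2ic^2t}e^{i\tau\mathcal A_c}\varphi_2\big(i\tau(-2c^2-\mathcal A_c)\big)\big[\bar v^2\mathcal A_cv-2|v|^2\mathcal A_c\bar v\big]\\ &+\tau e^{-4ic^2t}e^{i\tau\mathcal A_c}\varphi_1\big(i\tau(-4c^2-\mathcal A_c)\big)\bar v^3\\ &-i\tau^2e^{-4ic^2t}e^{i\tau\mathcal A_c}\varphi_2\big(i\tau(-4c^2-\mathcal A_c)\big)\big[3\bar v^2\mathcal A_c\bar v\big]\\ &-\tau^2\tfrac{3i}8e^{2ic^2t}v^2J_c\big[3\varphi_2(2ic^2\tau)|v|^2v+\Omega_2(v)\big]\\ &-\tau^2\tfrac{3i}8e^{-2ic^2t}\bar v^2J_c\big[3\varphi_2(-2ic^2\tau)|v|^2v+\Omega_{-2}(v)\big]\\ &+\tau^2\tfrac{6i}8e^{-2ic^2t}|v|^2J_c\big[3\varphi_2(-2ic^2\tau)|v|^2\bar v+\overline\Omega_{-2}(v)\big]\\ &+\tau^2\tfrac{3i}8e^{-4ic^2t}\bar v^2J_c\big[3\varphi_2(-4ic^2\tau)|v|^2\bar v+\overline\Omega_{-4}(v)\big].\end{aligned}$$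 Given real-valued initial data $z(0)$, $z'(0)$ of the Klein--Gordon equation $c^{-2}\partial_{tt}z-\Delta z+c^2z=|z|^2z$ (here $z'(0)=\partial_tz(0)$), the second-order scheme is defined, with $t_n=n\tau$, $u_*^0=z(0)-ic^{-1}\langle\nabla\rangle_c^{-1}z'(0)$ and $U^n=e^{i\frac\tau2\mathcal A_c}u_*^n$, by $$\begin{aligned}u_*^{n+1}={}&e^{i\frac\tau2\mathcal A_c}e^{-i\tau\frac38|U^n|^2}U^n-\tau\tfrac{3i}8(J_c-1)e^{i\frac\tau2\mathcal A_c}|U^n|^2U^n+\tau^2\theta(U^n)\\ &-\tau^2\tfrac3{64}J_c\big[2|u_*^n|^2J_c\vartheta(u_*^n)-(u_*^n)^2J_c\overline{\vartheta(u_*^n)}\big]-\tfrac i8J_cI(t_n,\tau,u_*^n),\end{aligned}$$ where $\vartheta$ and the $\Omega_l$ are taken at $t=t_n$. For functions $\varphi,\gamma$ the Strang splitting of the limit Schr\"odinger equation $i\partial_tu=\frac12\Delta u+\frac38|u|^2u$, $u(0)=\varphi-i\gamma$, is $$u_{*,\infty}^{n+1}=e^{-i\frac\tau2\frac\Delta2}e^{-i\tau\frac38|e^{-i\frac\tau2\frac\Delta2}u_{*,\infty}^n|^2}e^{-i\frac\tau2\frac\Delta2}u_{*,\infty}^n,\qquad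 u_{*,\infty}^0=\varphi-i\gamma.$$ **Lemma.** Fix $r>d/2$, $M_3\ge0$ and $\kappa\ge0$. Then there exist $T>0$, $\tau_0>0$ and $K\ge0$, depending only on $d,r,M_3,\kappa$, such that the following holds for every $c>0$. Let $z(0)\in H^{r+3}$ and $z'(0)\in H^{r+2}$ be real-valued with $$\|z(0)\|_{r+3}+\|c^{-1}\langle\nabla\rangle_c^{-1}z'(0)\|_{r+3}\le M_3,$$ and let $\varphi,\gamma$ be functions in $H^r$ with $$\|z(0)-\varphi\|_r+\|c^{-1}\langle\nabla\rangle_c^{-1}z'(0)-\gamma\|_r\le\kappa c^{-1}.$$ Then for all $0<\tau\le\tau_0$ with $\tau c\ge1$ and all integers $n\ge0$ with $t_n=n\tau\le T$, $$\|u_*^n-u_{*,\infty}^n\|_r\le Kc^{-1}.$$ -/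

import Mathlib

open scoped NNReal ENNReal

noncomputable section

namespace KleinGordon

/-- Complex-valued continuous functions on the torus `𝕋ᵈ = ℝᵈ / (2πℤ)ᵈ`, in the coordinate
`y = x / (2π)`.  In this coordinate `e^{i k·x}` is `UnitAddTorus.mFourier k`, the normalised Fourier
coefficient `(2π)⁻ᵈ ∫ u(x) e^{-i k·x} dx` is `UnitAddTorus.mFourierCoeff u k`, and the Laplacian in
`x` has the symbol `-|k|²`.  Every element of `Hˢ(𝕋ᵈ)`, `s > d/2`, is such a function. -/
abbrev Fn (d : ℕ) : Type := C(UnitAddTorus (Fin d), ℂ)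

variable {d : ℕ}

/-- `|k|² = k·k`. -/
def normSq (k : Fin d → ℤ) : ℝ := ∑ i, (k i : ℝ) ^ 2

/-- The Sobolev norm `‖u‖_s = (∑ₖ (1 + |k|²)ˢ |ûₖ|²)^{1/2}`, with the value `∞` if `u ∉ Hˢ`. -/
def sobolevNorm (s : ℝ) (u : Fn d) : ℝ≥0∞ :=
  (∑' k : Fin d → ℤ,
    ENNReal.ofReal ((1 + normSq k) ^ s * ‖UnitAddTorus.mFourierCoeff u k‖ ^ 2)) ^ (1 / 2 : ℝ)

/-- The Fourier multiplier with symbol `m`: `u ↦ ∑ₖ m(k) ûₖ e^{i k·x}`. -/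
def fourierMul (m : (Fin d → ℤ) → ℂ) (u : Fn d) : Fn d :=
  ∑' k : Fin d → ℤ, (m k * UnitAddTorus.mFourierCoeff u k) • UnitAddTorus.mFourier k

/-- The symbol `√(c² + |k|²)` of `⟨∇⟩_c = √(-Δ + c²)`. -/
def bracketSym (c : ℝ) (k : Fin d → ℤ) : ℝ := Real.sqrt (c ^ 2 + normSq k)

/-- The symbol of `𝒜_c = c⟨∇⟩_c - c²`. -/
def symA (c : ℝ) (k : Fin d → ℤ) : ℝ := c * bracketSym c k - c ^ 2

/-- `𝒜_c`. -/
def opA (c : ℝ) : Fn d → Fn d := fourierMul fun k => (symA c k : ℂ)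

/-- `e^{i t 𝒜_c}`. -/
def expA (c t : ℝ) : Fn d → Fn d :=
  fourierMul fun k => Complex.exp (Complex.I * (t * symA c k : ℝ))

/-- `c ⟨∇⟩_c⁻¹`. -/
def opJ (c : ℝ) : Fn d → Fn d := fourierMul fun k => ((c / bracketSym c k : ℝ) : ℂ)

/-- `c⁻¹ ⟨∇⟩_c⁻¹`. -/
def opJinv (c : ℝ) : Fn d → Fn d := fourierMul fun k => ((c⁻¹ * (bracketSym c k)⁻¹ : ℝ) : ℂ)

/-- `½Δ - 𝒜_c`. -/
def halfLapSubA (c : ℝ) : Fn d → Fn d :=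
  fourierMul fun k => ((-(normSq k / 2) - symA c k : ℝ) : ℂ)

/-- `e^{-i t Δ/2}`. -/
def schroedinger (t : ℝ) : Fn d → Fn d :=
  fourierMul fun k => Complex.exp (Complex.I * (t * (normSq k / 2) : ℝ))

/-- `φ₁(z) = (e^z - 1)/z`, with the removable singularity removed. -/
def phi1 (z : ℂ) : ℂ := if z = 0 then 1 else (Complex.exp z - 1) / z

/-- `φ₂(z) = (φ₀(z) - φ₁(z))/z = ∫₀¹ θ e^{θz} dθ`, `φ₀ = exp`, with the removable singularity
removed. -/
def phi2 (z : ℂ) : ℂ := if z = 0 then 1 / 2 else (Complex.exp z - phi1 z) / z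

/-- `φ(iτ(2c² - ½Δ))`. -/
def phiRes (φ : ℂ → ℂ) (c τ : ℝ) : Fn d → Fn d :=
  fourierMul fun k => φ (Complex.I * (τ * (2 * c ^ 2 + normSq k / 2) : ℝ))

/-- `φ(iτ(δc² - 𝒜_c))`. -/
def phiNonRes (φ : ℂ → ℂ) (c τ δ : ℝ) : Fn d → Fn d :=
  fourierMul fun k => φ (Complex.I * (τ * (δ * c ^ 2 - symA c k) : ℝ))

/-- The oscillatory phase `e^{i a}`. -/
def phase (a : ℝ) : ℂ := Complex.exp (Complex.I * (a : ℂ))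

/-- The pointwise exponential `x ↦ e^{g(x)}`. -/
def expFn (g : Fn d) : Fn d := (⟨Complex.exp, Complex.continuous_exp⟩ : C(ℂ, ℂ)).comp g

/-- `|v|²`. -/
def absSq (v : Fn d) : Fn d := v * star v

/-- `e^{-iτ(3/8)|v|²} v`. -/
def nonlinFlow (τ : ℝ) (v : Fn d) : Fn d :=
  expFn ((-(Complex.I * (τ : ℂ) * (3 / 8))) • absSq v) * v

/-- `ϑ_{c²}(t, τ, v)`. -/
def vartheta (c t τ : ℝ) (v : Fn d) : Fn d :=
  (phase (2 * c ^ 2 * t) *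
      ((phi1 (2 * Complex.I * c ^ 2 * τ) - 1) / (2 * Complex.I * τ * c ^ 2))) • v ^ 3
  + (3 * phase (-2 * c ^ 2 * t) *
      ((phi1 (-2 * Complex.I * c ^ 2 * τ) - 1) / (-2 * Complex.I * τ * c ^ 2))) • (absSq v * star v)
  + (phase (-4 * c ^ 2 * t) *
      ((phi1 (-4 * Complex.I * c ^ 2 * τ) - 1) / (-4 * Complex.I * τ * c ^ 2))) • (star v) ^ 3

/-- `Ω_{c²,l}(t, τ, v) = τ⁻² ∫₀^τ e^{ilc²s} Ψ_{c²}(t, s, v) ds` in closed form, where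
`Ψ_{c²}(t, s, v) = s e^{2ic²t} φ₁(2ic²s) v³ + 3 s e^{-2ic²t} φ₁(-2ic²s) |v|² v̄
  + s e^{-4ic²t} φ₁(-4ic²s) v̄³`. -/
def Omega (c : ℝ) (l : ℤ) (t τ : ℝ) (v : Fn d) : Fn d :=
  (phase (2 * c ^ 2 * t) *
      ((phi1 (((l : ℂ) + 2) * Complex.I * c ^ 2 * τ) - phi1 ((l : ℂ) * Complex.I * c ^ 2 * τ)) /
        (2 * Complex.I * τ * c ^ 2))) • v ^ 3
  + (3 * phase (-2 * c ^ 2 * t) *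
      ((phi1 (((l : ℂ) - 2) * Complex.I * c ^ 2 * τ) - phi1 ((l : ℂ) * Complex.I * c ^ 2 * τ)) /
        (-2 * Complex.I * τ * c ^ 2))) • (absSq v * star v)
  + (phase (-4 * c ^ 2 * t) *
      ((phi1 (((l : ℂ) - 4) * Complex.I * c ^ 2 * τ) - phi1 ((l : ℂ) * Complex.I * c ^ 2 * τ)) /
        (-4 * Complex.I * τ * c ^ 2))) • (star v) ^ 3

/-- The two readings of the symbol `Ω̄_{c²,l}`: for `σ = 1` the complex conjugate of `Ω_{c²,l}`, and
for `σ = -1` the integral `τ⁻² ∫₀^τ e^{ilc²s} conj(Ψ_{c²}(t, s, v)) ds = conj(Ω_{c²,-l})`. -/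
def OmegaBar (σ : ℤ) (c : ℝ) (l : ℤ) (t τ : ℝ) (v : Fn d) : Fn d :=
  star (Omega c (σ * l) t τ v)

/-- `θ_{c⟨∇⟩_c-1}(t, τ, v)` (which does not depend on `t`). -/
def theta (c τ : ℝ) (v : Fn d) : Fn d :=
  -((1 / 2 * (9 / 64) : ℂ) •
      expA c (τ / 2) (opJ c (absSq v ^ 2 * v) - absSq v ^ 2 * v))
  - (1 / 2 * (9 / 32) : ℂ) •
      opJ c (expA c (τ / 2) (absSq v * (opJ c (absSq v * v) - absSq v * v)))
  + (1 / 2 * (9 / 64) : ℂ) •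
      opJ c (expA c (τ / 2) (v ^ 2 * (opJ c (absSq v * star v) - absSq v * star v)))

/-- The highly oscillatory term `I¹_{c²}(τ, t, u)`. -/
def oscTerm (σ : ℤ) (c τ t : ℝ) (u : Fn d) : Fn d :=
  ((τ : ℂ) * phase (2 * c ^ 2 * t)) • expA c τ (phiRes phi1 c τ (u ^ 3))
  + (Complex.I * (τ : ℂ) ^ 2 * phase (2 * c ^ 2 * t)) •
      expA c τ (phiRes phi2 c τ (halfLapSubA c (u ^ 3) + 3 * u ^ 2 * opA c u))
  + (3 * (τ : ℂ) * phase (-2 * c ^ 2 * t)) •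
      expA c τ (phiNonRes phi1 c τ (-2) (absSq u * star u))
  + (3 * Complex.I * (τ : ℂ) ^ 2 * phase (-2 * c ^ 2 * t)) •
      expA c τ (phiNonRes phi2 c τ (-2)
        ((star u) ^ 2 * opA c u - 2 * absSq u * opA c (star u)))
  + ((τ : ℂ) * phase (-4 * c ^ 2 * t)) • expA c τ (phiNonRes phi1 c τ (-4) ((star u) ^ 3))
  - (Complex.I * (τ : ℂ) ^ 2 * phase (-4 * c ^ 2 * t)) •
      expA c τ (phiNonRes phi2 c τ (-4) (3 * (star u) ^ 2 * opA c (star u)))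
  - ((τ : ℂ) ^ 2 * (3 * Complex.I / 8) * phase (2 * c ^ 2 * t)) •
      (u ^ 2 * opJ c ((3 * phi2 (2 * Complex.I * c ^ 2 * τ)) • (absSq u * u) + Omega c 2 t τ u))
  - ((τ : ℂ) ^ 2 * (3 * Complex.I / 8) * phase (-2 * c ^ 2 * t)) •
      ((star u) ^ 2 * opJ c ((3 * phi2 (-2 * Complex.I * c ^ 2 * τ)) • (absSq u * u)
        + Omega c (-2) t τ u))
  + ((τ : ℂ) ^ 2 * (6 * Complex.I / 8) * phase (-2 * c ^ 2 * t)) •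
      (absSq u * opJ c ((3 * phi2 (-2 * Complex.I * c ^ 2 * τ)) • (absSq u * star u)
        + OmegaBar σ c (-2) t τ u))
  + ((τ : ℂ) ^ 2 * (3 * Complex.I / 8) * phase (-4 * c ^ 2 * t)) •
      ((star u) ^ 2 * opJ c ((3 * phi2 (-4 * Complex.I * c ^ 2 * τ)) • (absSq u * star u)
        + OmegaBar σ c (-4) t τ u))

/-- One step of length `τ` of the second-order scheme, from time `t` to `t + τ`. -/
def schemeStep (σ : ℤ) (c τ t : ℝ) (u : Fn d) : Fn d :=
  let U := expA c (τ / 2) u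
  expA c (τ / 2) (nonlinFlow τ U)
  - ((τ : ℂ) * (3 * Complex.I / 8)) •
      (opJ c (expA c (τ / 2) (absSq U * U)) - expA c (τ / 2) (absSq U * U))
  + ((τ : ℂ) ^ 2) • theta c τ U
  - ((τ : ℂ) ^ 2 * (3 / 64)) •
      opJ c (2 * absSq u * opJ c (vartheta c t τ u) - u ^ 2 * opJ c (star (vartheta c t τ u)))
  - (Complex.I / 8) • opJ c (oscTerm σ c τ t u)

/-- The second-order scheme `u_*ⁿ` at `t_n = nτ`, for the data `z(0) = z₀`, `z'(0) = z₁`. -/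
def scheme (σ : ℤ) (c τ : ℝ) (z₀ z₁ : Fn d) : ℕ → Fn d
  | 0 => z₀ - Complex.I • opJinv c z₁
  | n + 1 => schemeStep σ c τ (n * τ) (scheme σ c τ z₀ z₁ n)

/-- The Strang splitting `u_{*,∞}ⁿ` for `i ∂ₜ u = ½Δu + ⅜|u|²u`, `u(0) = φ - iγ`. -/
def strang (τ : ℝ) (φ γ : Fn d) : ℕ → Fn d
  | 0 => φ - Complex.I • γ
  | n + 1 => schroedinger (τ / 2) (nonlinFlow τ (schroedinger (τ / 2) (strang τ φ γ n)))

end KleinGordon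

end

/-! The argument is the Lax scheme "stability plus consistency gives convergence", carried out in
Sobolev algebras. Consistency: in `H^r` one step of the scheme differs from one Strang step by `O(τ
c⁻¹)` when the argument is bounded in `H^{r+3}` (`schemeStep_sub_strangStep`). Replacing `e^{it𝒜_c}`
by the Schrödinger group costs `t c⁻¹` and three derivatives, `J_c - 1` costs `c⁻¹` and one
derivative, and everything else oscillates. An oscillating term carries `φ₁` or `φ₂` at a purely
imaginary argument of modulus at least `2τc²`, or a divided difference of `φ₁` with such a
denominator, hence a factor of order `(τc²)⁻¹`. Multiplied by `τ` this is `c⁻²`, and `c⁻² ≤ τ c⁻¹`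
precisely because `τc ≥ 1`.

Stability: the consistency error is evaluated along the scheme, so its iterates must stay bounded in
`H^{r+3}` uniformly in `c` (`SobolevBound.schemeStep`). The danger is `𝒜_c` inside the `φ₂` terms,
which loses derivatives. The multiplier `φ₂` gives them back: two derivatives at cost `1/τ` in the
resonant case, one derivative at cost `1/(τc)` otherwise, the latter cancelling the factor `c` of
`𝒜_c` seen as an operator of order one. The prefactor `τ²` then leaves growth `O(τ)`, so a ball is
preserved up to a time `T`.

The Strang iterates are needed only in `H^r`, where the Strang step is Lipschitz with constant `1 +
O(τ)`. The discrete Gronwall inequality sums the local errors. Both uses of the error analysis share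
`schemeStep_sub`, with a parameter `e` equal to `1` for stability and to `c⁻¹` for consistency. -/

noncomputable section

namespace KleinGordon

variable {d : ℕ}

/-! ### Fourier coefficients and multipliers on the torus. -/

section Coefficients

open MeasureTheory UnitAddTorus

attribute [local instance] instMeasureSpaceUnitAddCircle
attribute [local instance] instIsProbabilityMeasureUnitAddCircleVolume

/-- The `k`-th Fourier coefficient as a continuous linear functional. -/
def coeff (k : Fin d → ℤ) : Fn d →L[ℂ] ℂ :=
  (innerSL ℂ (mFourierBasis (d := Fin d) k)).comp (ContinuousMap.toLp 2 volume ℂ)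

theorem coeff_apply (k : Fin d → ℤ) (u : Fn d) : coeff k u = mFourierCoeff u k := by
  rw [← mFourierCoeff_toLp, ← mFourierBasis_repr, HilbertBasis.repr_apply_apply]
  rfl

theorem coeff_mFourier (k j : Fin d → ℤ) : coeff k (mFourier j) = if k = j then 1 else 0 := by
  have h := orthonormal_iff_ite.mp (mFourierBasis (d := Fin d)).orthonormal k j
  rw [← h, coe_mFourierBasis]
  simp only [coeff, coe_mFourierBasis]
  rfl

theorem coeff_mFourier_mul (k j : Fin d → ℤ) (v : Fn d) :
    coeff k (mFourier j * v) = coeff (k - j) v := by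
  rw [coeff_apply, coeff_apply]
  unfold mFourierCoeff
  congr 1
  ext x
  have h : mFourier (-(k - j)) x = mFourier (-k) x * mFourier j x := by
    rw [← mFourier_add]; congr 2; abel
  simp only [ContinuousMap.mul_apply, smul_eq_mul, h, mul_assoc]

theorem coeff_star (k : Fin d → ℤ) (v : Fn d) : coeff k (star v) = star (coeff (-k) v) := by
  rw [coeff_apply, coeff_apply]
  unfold mFourierCoeff
  rw [Complex.star_def, ← integral_conj]
  congr 1
  ext x
  simp [mFourier_neg, mul_comm]

end Coefficients

open UnitAddTorus

theorem hasSum_coeff {u : Fn d} (h : Summable fun k => coeff k u) :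
    HasSum (fun k => coeff k u • mFourier k) u := by
  simp only [coeff_apply] at h ⊢
  exact hasSum_mFourier_series_of_summable h

theorem coeff_of_hasSum {a : (Fin d → ℤ) → ℂ} {u : Fn d}
    (h : HasSum (fun k => a k • mFourier k) u) (k : Fin d → ℤ) : coeff k u = a k := by
  have h1 := h.mapL (coeff k)
  have h2 : HasSum (fun j => coeff k (a j • mFourier j)) (a k) := by
    convert hasSum_ite_eq k (a k) using 2 with j
    rw [map_smul, coeff_mFourier]
    by_cases hj : j = k
    · simp [hj]
    · simp [hj, Ne.symm hj]
  exact h1.unique h2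

theorem coeff_mul {u : Fn d} (h : Summable fun k => coeff k u) (v : Fn d) (k : Fin d → ℤ) :
    HasSum (fun j => coeff j u * coeff (k - j) v) (coeff k (u * v)) := by
  have h1 := ((hasSum_coeff h).mul_right v).mapL (coeff k)
  convert h1 using 2 with j
  rw [smul_mul_assoc, map_smul, coeff_mFourier_mul, smul_eq_mul]

/-- In the absence of summability the multiplier has the value zero, so the bound always holds. -/
theorem norm_coeff_fourierMul_le (m : (Fin d → ℤ) → ℂ) (u : Fn d) (k : Fin d → ℤ) :
    ‖coeff k (fourierMul m u)‖ ≤ ‖m k * coeff k u‖ := by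
  unfold fourierMul
  simp only [← coeff_apply]
  by_cases h : Summable fun k => (m k * coeff k u) • (mFourier k : Fn d)
  · rw [coeff_of_hasSum h.hasSum]
  · rw [tsum_eq_zero_of_not_summable h, map_zero, norm_zero]; exact norm_nonneg _

theorem coeff_fourierMul {m : (Fin d → ℤ) → ℂ} {u : Fn d}
    (h : Summable fun k => m k * coeff k u) (k : Fin d → ℤ) :
    coeff k (fourierMul m u) = m k * coeff k u := by
  unfold fourierMul
  simp only [← coeff_apply]
  refine coeff_of_hasSum (Summable.hasSum ?_) k
  refine .of_norm ?_
  simpa only [norm_smul, mFourier_norm, mul_one] using h.norm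

/-! ### Weighted sequence inequalities in `ℓ²`. -/

/-- The `ℓ²` norm of a family of extended nonnegative reals. -/
def l2 {ι : Type*} (f : ι → ℝ≥0∞) : ℝ≥0∞ := (∑' k, f k ^ 2) ^ (1 / 2 : ℝ)

section EllTwo

variable {ι : Type*}

theorem l2_sq (f : ι → ℝ≥0∞) : l2 f ^ 2 = ∑' k, f k ^ 2 := by
  rw [l2, ← ENNReal.rpow_natCast, ← ENNReal.rpow_mul]; norm_num

theorem l2_le_iff {f : ι → ℝ≥0∞} {A : ℝ≥0∞} : l2 f ≤ A ↔ ∑' k, f k ^ 2 ≤ A ^ 2 := by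
  rw [← l2_sq]
  exact (ENNReal.pow_le_pow_left_iff two_ne_zero).symm

theorem l2_mono {f g : ι → ℝ≥0∞} (h : ∀ k, f k ≤ g k) : l2 f ≤ l2 g := by
  rw [l2_le_iff, l2_sq]
  exact ENNReal.tsum_le_tsum fun k => pow_le_pow_left' (h k) 2

theorem l2_const_mul (c : ℝ≥0∞) (f : ι → ℝ≥0∞) : l2 (fun k => c * f k) = c * l2 f := by
  have : l2 (fun k => c * f k) ^ 2 = (c * l2 f) ^ 2 := by
    rw [l2_sq, mul_pow, l2_sq, ← ENNReal.tsum_mul_left]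
    simp only [mul_pow]
  exact le_antisymm ((ENNReal.pow_le_pow_left_iff two_ne_zero).1 this.le)
    ((ENNReal.pow_le_pow_left_iff two_ne_zero).1 this.ge)

theorem tsum_mul_le_l2 (f g : ι → ℝ≥0∞) : ∑' k, f k * g k ≤ l2 f * l2 g := by
  rw [ENNReal.tsum_eq_iSup_sum]
  refine iSup_le fun s => ?_
  have h := ENNReal.inner_le_Lp_mul_Lq s f g Real.HolderConjugate.two_two
  simp only [ENNReal.rpow_two] at h
  refine h.trans ?_
  unfold l2
  gcongr <;> exact ENNReal.sum_le_tsum s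

theorem l2_add_le (f g : ι → ℝ≥0∞) : l2 (fun k => f k + g k) ≤ l2 f + l2 g := by
  rw [l2_le_iff, ENNReal.tsum_eq_iSup_sum]
  refine iSup_le fun s => ?_
  have h := ENNReal.Lp_add_le s f g (p := 2) one_le_two
  simp only [ENNReal.rpow_two] at h
  have h2 : (∑ i ∈ s, (f i + g i) ^ 2) ^ (1 / 2 : ℝ) ≤ l2 f + l2 g := by
    refine h.trans ?_
    unfold l2
    gcongr <;> exact ENNReal.sum_le_tsum s
  calc ∑ i ∈ s, (f i + g i) ^ 2 = ((∑ i ∈ s, (f i + g i) ^ 2) ^ (1 / 2 : ℝ)) ^ 2 := by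
        rw [← ENNReal.rpow_natCast, ← ENNReal.rpow_mul]; norm_num
    _ ≤ _ := pow_le_pow_left' h2 2

/-- Young's inequality `ℓ² * ℓ¹ ⊆ ℓ²`. -/
theorem l2_convolution_le [AddCommGroup ι] (f g : ι → ℝ≥0∞) :
    l2 (fun k => ∑' j, f j * g (k - j)) ≤ l2 f * ∑' k, g k := by
  have hg : ∀ k, ∑' j, g (k - j) = ∑' j, g j := fun k => (Equiv.subLeft k).tsum_eq g
  have hg' : ∀ j, ∑' k, g (k - j) = ∑' k, g k := fun j => (Equiv.subRight j).tsum_eq g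
  have hsqrt : ∀ x : ℝ≥0∞, x ^ (1 / 2 : ℝ) * x ^ (1 / 2 : ℝ) = x := fun x => by
    rw [← ENNReal.rpow_add_of_nonneg _ _ (by norm_num) (by norm_num)]; norm_num
  rw [l2_le_iff]
  calc ∑' k, (∑' j, f j * g (k - j)) ^ 2
      ≤ ∑' k, (∑' j, f j ^ 2 * g (k - j)) * ∑' j, g j := by
        refine ENNReal.tsum_le_tsum fun k => ?_
        have h := tsum_mul_le_l2 (fun j => f j * g (k - j) ^ (1 / 2 : ℝ))
          (fun j => g (k - j) ^ (1 / 2 : ℝ))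
        simp only [mul_assoc, hsqrt] at h
        refine (pow_le_pow_left' h 2).trans (le_of_eq ?_)
        rw [mul_pow, l2_sq, l2_sq]
        simp only [mul_pow, sq (_ ^ (1 / 2 : ℝ)), hsqrt, hg]
    _ = (l2 f * ∑' k, g k) ^ 2 := by
        rw [ENNReal.tsum_mul_right, ENNReal.tsum_comm, mul_pow, l2_sq, sq (∑' k, g k), ← mul_assoc]
        simp only [ENNReal.tsum_mul_left, hg', ENNReal.tsum_mul_right]

end EllTwo

/-! ### Sobolev norms and the algebra property. -/

/-- `⟨k⟩ = √(1 + |k|²)`. -/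
def jap (k : Fin d → ℤ) : ℝ := Real.sqrt (1 + normSq k)

theorem normSq_nonneg (k : Fin d → ℤ) : 0 ≤ normSq k := Finset.sum_nonneg fun _ _ => sq_nonneg _

theorem jap_sq (k : Fin d → ℤ) : jap k ^ 2 = 1 + normSq k :=
  Real.sq_sqrt (by linarith [normSq_nonneg k])

theorem one_le_jap (k : Fin d → ℤ) : 1 ≤ jap k :=
  Real.one_le_sqrt.2 (by linarith [normSq_nonneg k])

theorem jap_pos (k : Fin d → ℤ) : 0 < jap k := one_pos.trans_le (one_le_jap k)

theorem jap_neg (k : Fin d → ℤ) : jap (-k) = jap k := by simp [jap, normSq]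

theorem jap_add_le (j l : Fin d → ℤ) : jap (j + l) ≤ 2 * max (jap j) (jap l) := by
  have h : normSq (j + l) ≤ 2 * normSq j + 2 * normSq l := by
    simp only [normSq, Finset.mul_sum, ← Finset.sum_add_distrib]
    refine Finset.sum_le_sum fun i _ => ?_
    simp only [Pi.add_apply]; push_cast
    nlinarith [sq_nonneg ((j i : ℝ) - l i)]
  have hj := jap_sq j
  have hl := jap_sq l
  have hm : ∀ x ∈ ({jap j, jap l} : Set ℝ), x ^ 2 ≤ max (jap j) (jap l) ^ 2 := by
    rintro x (rfl | rfl)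
    · exact pow_le_pow_left₀ (jap_pos j).le (le_max_left _ _) 2
    · exact pow_le_pow_left₀ (jap_pos l).le (le_max_right _ _) 2
  have h1 := hm _ (Or.inl rfl)
  have h2 := hm _ (Or.inr rfl)
  refine Real.sqrt_le_iff.2 ⟨mul_nonneg zero_le_two ((jap_pos j).le.trans (le_max_left _ _)), ?_⟩
  nlinarith

theorem jap_rpow_add_le {s : ℝ} (hs : 0 ≤ s) (j l : Fin d → ℤ) :
    jap (j + l) ^ s ≤ 2 ^ s * (jap j ^ s + jap l ^ s) := by
  have hj := jap_pos j
  have hl := jap_pos l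
  refine (Real.rpow_le_rpow (jap_pos _).le (jap_add_le j l) hs).trans ?_
  rw [Real.mul_rpow zero_le_two (hj.le.trans (le_max_left _ _))]
  gcongr
  rcases max_cases (jap j) (jap l) with ⟨h, -⟩ | ⟨h, -⟩ <;> rw [h]
  · linarith [Real.rpow_pos_of_pos hl s]
  · linarith [Real.rpow_pos_of_pos hj s]

theorem sobolevNorm_eq_l2 (s : ℝ) (u : Fn d) :
    sobolevNorm s u = l2 fun k => ENNReal.ofReal (jap k ^ s) * ‖coeff k u‖ₑ := by
  unfold sobolevNorm l2
  congr 2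
  ext k
  have hj := jap_pos k
  change _ = (ENNReal.ofReal (jap k ^ s) * ‖coeff k u‖ₑ) ^ 2
  rw [← ofReal_norm (coeff k u), ← ENNReal.ofReal_mul (by positivity), ← ENNReal.ofReal_pow
    (by positivity), coeff_apply, mul_pow, ← jap_sq, ← Real.rpow_natCast, ← Real.rpow_mul hj.le,
    ← Real.rpow_natCast (jap k ^ s), ← Real.rpow_mul hj.le, mul_comm s]

theorem norm_intCast_le_jap (k : Fin d → ℤ) : ‖fun i => (k i : ℝ)‖ ≤ jap k := by
  refine (pi_norm_le_iff_of_nonneg (jap_pos k).le).2 fun i => ?_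
  refine Real.le_sqrt_of_sq_le ?_
  rw [Real.norm_eq_abs, sq_abs]
  have : (k i : ℝ) ^ 2 ≤ normSq k :=
    Finset.single_le_sum (f := fun i => (k i : ℝ) ^ 2) (fun _ _ => sq_nonneg _) (Finset.mem_univ i)
  linarith

-- Comparison with the lattice sum over `ℤᵈ` in the sup norm, which converges because `2s` exceeds
-- the rank `d`. The origin is added separately, since `0` to a negative power has the value `0`
-- while `jap 0 = 1`.
open Submodule in
theorem summable_jap_rpow {s : ℝ} (hs : (d : ℝ) / 2 < s) :
    Summable fun k : Fin d → ℤ => jap k ^ (-2 * s) := by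
  have hs0 : 0 < s := lt_of_le_of_lt (by positivity) hs
  let b := Pi.basisFun ℝ (Fin d)
  let L : Submodule ℤ (Fin d → ℝ) := span ℤ (Set.range b)
  let bL : Module.Basis (Fin d) ℤ L := b.restrictScalars ℤ
  have hb : ∀ x, ((bL x : L) : Fin d → ℝ) = Pi.single x 1 := fun x => by
    rw [show bL x = (b.restrictScalars ℤ) x from rfl, Module.Basis.restrictScalars_apply]
    simp [b]
  have hrank : Module.finrank ℤ L = d := by
    rw [Module.finrank_eq_card_basis bL, Fintype.card_fin]
  have h := ZLattice.summable_norm_rpow L (-2 * s) (by rw [hrank]; linarith)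
  have h' := (bL.equivFun.symm.toEquiv.summable_iff (f := fun z : L => ‖z‖ ^ (-2 * s))).2 h
  have h1 : Summable fun k : Fin d → ℤ => if k = 0 then (1 : ℝ) else 0 :=
    (hasSum_ite_eq 0 1).summable
  refine Summable.of_nonneg_of_le (fun k => Real.rpow_nonneg (jap_pos k).le _) (fun k => ?_)
    (h'.add h1)
  by_cases hk : k = 0
  · simp [hk, jap, normSq, Real.zero_rpow, hs0.ne']
  · have hn : ((bL.equivFun.symm k : L) : Fin d → ℝ) = fun i => (k i : ℝ) := by
      ext i
      simp [Module.Basis.equivFun_symm_apply, Finset.sum_apply, hb, Pi.single_apply]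
    have hpos : 0 < ‖fun i => (k i : ℝ)‖ := by
      rw [norm_pos_iff]
      exact fun h0 => hk (funext fun i => by simpa using congrFun h0 i)
    simp only [Function.comp_apply, hk, if_false, add_zero]
    change _ ≤ ‖((bL.equivFun.symm k : L) : Fin d → ℝ)‖ ^ _
    rw [hn]
    exact Real.rpow_le_rpow_of_nonpos hpos (norm_intCast_le_jap k) (by linarith)

theorem l2_jap_ne_top {s : ℝ} (hs : (d : ℝ) / 2 < s) :
    l2 (fun k : Fin d → ℤ => ENNReal.ofReal (jap k ^ (-s))) ≠ ⊤ := by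
  have h := summable_jap_rpow hs
  unfold l2
  refine ENNReal.rpow_ne_top_of_nonneg (by norm_num) ?_
  convert h.tsum_ofReal_ne_top using 2
  ext k
  rw [← ENNReal.ofReal_pow (Real.rpow_nonneg (jap_pos k).le _), ← Real.rpow_natCast,
    ← Real.rpow_mul (jap_pos k).le]
  congr 2
  push_cast; ring

/-- Cauchy–Schwarz against the weight `jap ^ (-s)`. For `s > d/2` this embeds `H^s` in the Wiener
algebra of absolutely convergent Fourier series. -/
theorem tsum_enorm_coeff_le (s : ℝ) (u : Fn d) :
    ∑' k, ‖coeff k u‖ₑ ≤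
      l2 (fun k : Fin d → ℤ => ENNReal.ofReal (jap k ^ (-s))) * sobolevNorm s u := by
  rw [sobolevNorm_eq_l2]
  refine le_trans (le_of_eq (tsum_congr fun k => ?_)) (tsum_mul_le_l2 _ _)
  rw [← mul_assoc, ← ENNReal.ofReal_mul (Real.rpow_nonneg (jap_pos k).le _),
    ← Real.rpow_add (jap_pos k)]
  simp

theorem summable_coeff {s : ℝ} (hs : (d : ℝ) / 2 < s) {u : Fn d} (hu : sobolevNorm s u ≠ ⊤) :
    Summable fun k => coeff k u := by
  have h : ∑' k, ‖coeff k u‖ₑ ≠ ⊤ :=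
    ne_top_of_le_ne_top (ENNReal.mul_ne_top (l2_jap_ne_top hs) hu) (tsum_enorm_coeff_le s u)
  exact Summable.of_enorm h

theorem sobolevNorm_le_of_coeff {s s' : ℝ} {b : ℝ} {u v : Fn d} (hb : 0 ≤ b)
    (h : ∀ k, jap k ^ s * ‖coeff k v‖ ≤ b * (jap k ^ s' * ‖coeff k u‖)) :
    sobolevNorm s v ≤ ENNReal.ofReal b * sobolevNorm s' u := by
  rw [sobolevNorm_eq_l2, sobolevNorm_eq_l2, ← l2_const_mul]
  refine l2_mono fun k => ?_
  have hj := jap_pos k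
  rw [← ofReal_norm, ← ofReal_norm, ← ENNReal.ofReal_mul (by positivity),
    ← ENNReal.ofReal_mul (by positivity), ← ENNReal.ofReal_mul hb]
  exact ENNReal.ofReal_le_ofReal (h k)

theorem sobolevNorm_mono {s s' : ℝ} (h : s ≤ s') (u : Fn d) :
    sobolevNorm s u ≤ sobolevNorm s' u := by
  simpa using sobolevNorm_le_of_coeff (b := 1) (u := u) (v := u) zero_le_one fun k => by
    rw [one_mul]
    gcongr
    exact one_le_jap k

theorem sobolevNorm_add_le (s : ℝ) (u v : Fn d) :
    sobolevNorm s (u + v) ≤ sobolevNorm s u + sobolevNorm s v := by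
  simp only [sobolevNorm_eq_l2]
  refine le_trans (l2_mono fun k => ?_) (l2_add_le _ _)
  rw [← mul_add, map_add]
  gcongr
  exact enorm_add_le _ _

theorem sobolevNorm_smul_le (s : ℝ) (a : ℂ) (u : Fn d) :
    sobolevNorm s (a • u) ≤ ENNReal.ofReal ‖a‖ * sobolevNorm s u :=
  sobolevNorm_le_of_coeff (norm_nonneg _) fun k => by
    rw [map_smul, norm_smul]; exact le_of_eq (by ring)

theorem sobolevNorm_neg (s : ℝ) (u : Fn d) : sobolevNorm s (-u) = sobolevNorm s u := by
  simp only [sobolevNorm_eq_l2, map_neg, enorm_neg]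

theorem sobolevNorm_zero (s : ℝ) : sobolevNorm s (0 : Fn d) = 0 := by
  simp [sobolevNorm_eq_l2, l2]

theorem sobolevNorm_star (s : ℝ) (u : Fn d) : sobolevNorm s (star u) = sobolevNorm s u := by
  simp only [sobolevNorm_eq_l2, l2]
  congr 1
  rw [← (Equiv.neg (Fin d → ℤ)).tsum_eq]
  refine tsum_congr fun k => ?_
  rw [Equiv.neg_apply, coeff_star, jap_neg, neg_neg, Complex.star_def, RCLike.enorm_conj]

/-- The weight at `k = j + (k - j)` is at most `2 ^ s` times the sum of the weights at `j` and `k -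
j`. Each half is a convolution of an `ℓ²` and an `ℓ¹` sequence, so Young's inequality applies.
Finiteness for `u` makes the coefficients of the product an actual convolution. -/
theorem sobolevNorm_mul_le {s r : ℝ} (hr : (d : ℝ) / 2 < r) (hrs : r ≤ s) {u v : Fn d}
    (hu : sobolevNorm s u ≠ ⊤) :
    sobolevNorm s (u * v) ≤ ENNReal.ofReal (2 ^ s) * (2 *
      l2 (fun k : Fin d → ℤ => ENNReal.ofReal (jap k ^ (-r)))) *
        (sobolevNorm s u * sobolevNorm s v) := by
  have hs0 : 0 ≤ s := le_trans (by positivity) (hr.le.trans hrs)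
  have hsum := summable_coeff (hr.trans_le hrs) hu
  set S := l2 (fun k : Fin d → ℤ => ENNReal.ofReal (jap k ^ (-r)))
  set f : (Fin d → ℤ) → ℝ≥0∞ := fun k => ENNReal.ofReal (jap k ^ s) * ‖coeff k u‖ₑ with hf
  set g : (Fin d → ℤ) → ℝ≥0∞ := fun k => ENNReal.ofReal (jap k ^ s) * ‖coeff k v‖ₑ with hg
  have hl1 : ∀ w : Fn d, ∑' k, ‖coeff k w‖ₑ ≤ S * sobolevNorm s w := fun w =>
    (tsum_enorm_coeff_le r w).trans (by gcongr; exact sobolevNorm_mono hrs w)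
  have key : ∀ k, ENNReal.ofReal (jap k ^ s) * ‖coeff k (u * v)‖ₑ ≤
      ENNReal.ofReal (2 ^ s) * (∑' j, f j * ‖coeff (k - j) v‖ₑ +
        ∑' j, g j * ‖coeff (k - j) u‖ₑ) := fun k => by
    have hflip : ∑' j, g j * ‖coeff (k - j) u‖ₑ = ∑' j, g (k - j) * ‖coeff j u‖ₑ := by
      rw [← (Equiv.subLeft k).tsum_eq]
      simp
    rw [hflip, ← ENNReal.tsum_add, ← ENNReal.tsum_mul_left, ← (coeff_mul hsum v k).tsum_eq]
    refine (mul_le_mul_right (enorm_tsum_le_tsum_enorm) _).trans ?_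
    rw [← ENNReal.tsum_mul_left]
    refine ENNReal.tsum_le_tsum fun j => ?_
    have hw : ENNReal.ofReal (jap k ^ s) ≤ ENNReal.ofReal (2 ^ s) *
        (ENNReal.ofReal (jap j ^ s) + ENNReal.ofReal (jap (k - j) ^ s)) := by
      have h1 := Real.rpow_pos_of_pos (jap_pos j) s
      have h2 := Real.rpow_pos_of_pos (jap_pos (k - j)) s
      rw [← ENNReal.ofReal_add h1.le h2.le, ← ENNReal.ofReal_mul (by positivity)]
      refine ENNReal.ofReal_le_ofReal ?_
      simpa using jap_rpow_add_le hs0 j (k - j)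
    rw [enorm_mul]
    calc _ ≤ ENNReal.ofReal (2 ^ s) * (ENNReal.ofReal (jap j ^ s) + ENNReal.ofReal
          (jap (k - j) ^ s)) * (‖coeff j u‖ₑ * ‖coeff (k - j) v‖ₑ) := by gcongr
      _ = _ := by simp only [hf, hg]; ring
  have hU : l2 f = sobolevNorm s u := (sobolevNorm_eq_l2 s u).symm
  have hV : l2 g = sobolevNorm s v := (sobolevNorm_eq_l2 s v).symm
  calc sobolevNorm s (u * v)
      ≤ ENNReal.ofReal (2 ^ s) * (l2 f * ∑' k, ‖coeff k v‖ₑ + l2 g * ∑' k, ‖coeff k u‖ₑ) := by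
        rw [sobolevNorm_eq_l2]
        refine (l2_mono key).trans ?_
        rw [l2_const_mul]
        gcongr
        refine (l2_add_le _ _).trans ?_
        gcongr <;> exact l2_convolution_le _ _
    _ ≤ ENNReal.ofReal (2 ^ s) * (sobolevNorm s u * (S * sobolevNorm s v) +
          sobolevNorm s v * (S * sobolevNorm s u)) := by
        rw [hU, hV]
        gcongr <;> exact hl1 _
    _ = _ := by ring

/-- The Sobolev norm is lower semicontinuous with respect to uniform convergence. -/
theorem sobolevNorm_le_of_tendsto {s : ℝ} {A : ℝ≥0∞} {p : ℕ → Fn d} {u : Fn d}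
    (h : Filter.Tendsto p Filter.atTop (nhds u)) (hA : ∀ n, sobolevNorm s (p n) ≤ A) :
    sobolevNorm s u ≤ A := by
  rw [sobolevNorm_eq_l2, l2_le_iff, ENNReal.tsum_eq_iSup_sum]
  refine iSup_le fun F => ?_
  have ht : Filter.Tendsto
      (fun n => ∑ k ∈ F, (ENNReal.ofReal (jap k ^ s) * ‖coeff k (p n)‖ₑ) ^ 2) Filter.atTop
      (nhds (∑ k ∈ F, (ENNReal.ofReal (jap k ^ s) * ‖coeff k u‖ₑ) ^ 2)) := by
    refine tendsto_finsetSum _ fun k _ => ENNReal.Tendsto.pow (ENNReal.Tendsto.const_mul ?_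
      (Or.inr ENNReal.ofReal_ne_top))
    exact (((coeff k).continuous.tendsto u).comp h).enorm
  refine le_of_tendsto' ht fun n => ?_
  have h1 := hA n
  rw [sobolevNorm_eq_l2, l2_le_iff] at h1
  exact (ENNReal.sum_le_tsum F).trans h1

/-! ### Calculus of explicit Sobolev bounds. -/

/-- `C ≥ 1` is a constant for which `C ‖·‖_s` is submultiplicative, where `s > d/2`. -/
structure IsAlgConst (d : ℕ) (C s : ℝ) : Prop where
  one_le : 1 ≤ C
  lt : (d : ℝ) / 2 < s
  mul_le : ∀ u v : Fn d, sobolevNorm s u ≠ ⊤ →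
    sobolevNorm s (u * v) ≤ ENNReal.ofReal C * (sobolevNorm s u * sobolevNorm s v)

/-- One constant serves all exponents in `[r, r + 3]`, so a normalised bound stays valid when
derivatives are given up. -/
theorem exists_isAlgConst {r : ℝ} (hr : (d : ℝ) / 2 < r) :
    ∃ C, ∀ s, r ≤ s → s ≤ r + 3 → IsAlgConst d C s := by
  set S := l2 (fun k : Fin d → ℤ => ENNReal.ofReal (jap k ^ (-r))) with hS
  refine ⟨max 1 (2 ^ (r + 3) * (2 * S.toReal)), fun s hs hs' =>
    ⟨le_max_left _ _, hr.trans_le hs, fun u v hu => ?_⟩⟩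
  refine (sobolevNorm_mul_le hr hs hu).trans ?_
  gcongr
  refine le_trans ?_ (ENNReal.ofReal_le_ofReal (le_max_right _ _))
  rw [ENNReal.ofReal_mul (by positivity), ENNReal.ofReal_mul zero_le_two,
    ENNReal.ofReal_toReal (l2_jap_ne_top hr)]
  gcongr
  · norm_num
  · norm_num

/-- `A` is an upper bound of `C ‖u‖_s`. -/
structure SobolevBound (C s : ℝ) (u : Fn d) (A : ℝ) : Prop where
  nonneg : 0 ≤ A
  le : ENNReal.ofReal C * sobolevNorm s u ≤ ENNReal.ofReal A

namespace SobolevBound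

variable {C s s' A B b : ℝ} {u v w : Fn d}

theorem mono (h : SobolevBound C s u A) (hAB : A ≤ B) : SobolevBound C s u B :=
  ⟨h.nonneg.trans hAB, h.le.trans (ENNReal.ofReal_le_ofReal hAB)⟩

theorem anti (h : SobolevBound C s' u A) (hs : s ≤ s') : SobolevBound C s u A :=
  ⟨h.nonneg, le_trans (by gcongr; exact sobolevNorm_mono hs u) h.le⟩

theorem ne_top (h : SobolevBound C s u A) (hC : 1 ≤ C) : sobolevNorm s u ≠ ⊤ := fun ht => by
  have h1 := h.le
  rw [ht, ENNReal.mul_top (by simpa using one_pos.trans_le hC)] at h1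
  exact ENNReal.ofReal_ne_top (top_le_iff.1 h1)

theorem sobolevNorm_le (h : SobolevBound C s u A) (hC : 1 ≤ C) :
    sobolevNorm s u ≤ ENNReal.ofReal A :=
  le_trans (le_mul_of_one_le_left zero_le (by simpa using hC)) h.le

theorem of_sobolevNorm_le (hA : 0 ≤ A) (hC : 0 ≤ C) (h : sobolevNorm s u ≤ ENNReal.ofReal A) :
    SobolevBound C s u (C * A) :=
  ⟨by positivity, by rw [ENNReal.ofReal_mul hC]; gcongr⟩

theorem add (hu : SobolevBound C s u A) (hv : SobolevBound C s v B) :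
    SobolevBound C s (u + v) (A + B) :=
  ⟨add_nonneg hu.nonneg hv.nonneg, by
    rw [ENNReal.ofReal_add hu.nonneg hv.nonneg]
    exact le_trans (by rw [← mul_add]; gcongr; exact sobolevNorm_add_le s u v)
      (add_le_add hu.le hv.le)⟩

theorem neg (hu : SobolevBound C s u A) : SobolevBound C s (-u) A :=
  ⟨hu.nonneg, by rw [sobolevNorm_neg]; exact hu.le⟩

theorem sub (hu : SobolevBound C s u A) (hv : SobolevBound C s v B) :
    SobolevBound C s (u - v) (A + B) := by
  rw [sub_eq_add_neg]; exact hu.add hv.neg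

protected theorem star (hu : SobolevBound C s u A) : SobolevBound C s (star u) A :=
  ⟨hu.nonneg, by rw [sobolevNorm_star]; exact hu.le⟩

theorem zero : SobolevBound C s (0 : Fn d) 0 := ⟨le_rfl, by simp [sobolevNorm_zero]⟩

theorem smul {a : ℂ} (hu : SobolevBound C s u A) (ha : ‖a‖ ≤ b) :
    SobolevBound C s (a • u) (b * A) := by
  have hb : 0 ≤ b := (norm_nonneg a).trans ha
  refine ⟨mul_nonneg hb hu.nonneg, ?_⟩
  rw [ENNReal.ofReal_mul hb]
  calc _ ≤ ENNReal.ofReal C * (ENNReal.ofReal b * sobolevNorm s u) := by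
        gcongr
        refine (sobolevNorm_smul_le s a u).trans ?_
        gcongr
    _ = ENNReal.ofReal b * (ENNReal.ofReal C * sobolevNorm s u) := by ring
    _ ≤ _ := by gcongr; exact hu.le

theorem mul (hC : IsAlgConst d C s) (hu : SobolevBound C s u A) (hv : SobolevBound C s v B) :
    SobolevBound C s (u * v) (A * B) := by
  refine ⟨mul_nonneg hu.nonneg hv.nonneg, ?_⟩
  rw [ENNReal.ofReal_mul hu.nonneg]
  calc _ ≤ ENNReal.ofReal C * (ENNReal.ofReal C * (sobolevNorm s u * sobolevNorm s v)) := by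
        gcongr
        exact hC.mul_le u v (hu.ne_top hC.one_le)
    _ = (ENNReal.ofReal C * sobolevNorm s u) * (ENNReal.ofReal C * sobolevNorm s v) := by ring
    _ ≤ _ := mul_le_mul' hu.le hv.le

theorem pow_succ (hC : IsAlgConst d C s) (hu : SobolevBound C s u A) (n : ℕ) :
    SobolevBound C s (u ^ (n + 1)) (A ^ (n + 1)) := by
  induction n with
  | zero => simpa using hu
  | succ n ih => rw [_root_.pow_succ, _root_.pow_succ A]; exact ih.mul hC hu

theorem sq (hC : IsAlgConst d C s) (hu : SobolevBound C s u A) : SobolevBound C s (u ^ 2) (A ^ 2) :=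
  hu.pow_succ hC 1

theorem cube (hC : IsAlgConst d C s) (hu : SobolevBound C s u A) :
    SobolevBound C s (u ^ 3) (A ^ 3) :=
  hu.pow_succ hC 2

theorem absSq (hC : IsAlgConst d C s) (hu : SobolevBound C s u A) :
    SobolevBound C s (absSq u) (A ^ 2) := by
  rw [_root_.sq]; exact hu.mul hC hu.star

theorem absSq_mul (hC : IsAlgConst d C s) (hu : SobolevBound C s u A) :
    SobolevBound C s (KleinGordon.absSq u * u) (A ^ 3) := by
  rw [_root_.pow_succ]; exact (hu.absSq hC).mul hC hu

theorem absSq_mul_star (hC : IsAlgConst d C s) (hu : SobolevBound C s u A) :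
    SobolevBound C s (KleinGordon.absSq u * star u) (A ^ 3) := by
  rw [_root_.pow_succ]; exact (hu.absSq hC).mul hC hu.star

theorem ofNat_two_mul (hu : SobolevBound C s u A) : SobolevBound C s (2 * u) (2 * A) := by
  rw [two_mul, two_mul]; exact hu.add hu

theorem ofNat_three_mul (hu : SobolevBound C s u A) : SobolevBound C s (3 * u) (3 * A) := by
  rw [show (3 : Fn d) * u = 2 * u + u by ring, show 3 * A = 2 * A + A by ring]
  exact hu.ofNat_two_mul.add hu

protected theorem sum {ι : Type*} {F : Finset ι} {f : ι → Fn d} {a : ι → ℝ}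
    (h : ∀ i, SobolevBound C s (f i) (a i)) : SobolevBound C s (∑ i ∈ F, f i) (∑ i ∈ F, a i) := by
  classical
  induction F using Finset.induction_on with
  | empty => simpa using zero
  | insert i F hi ih => rw [Finset.sum_insert hi, Finset.sum_insert hi]; exact (h i).add ih

theorem of_tendsto {p : ℕ → Fn d} (hC : 1 ≤ C) (h : Filter.Tendsto p Filter.atTop (nhds u))
    (hp : ∀ n, SobolevBound C s (p n) A) : SobolevBound C s u A := by
  refine ⟨(hp 0).nonneg, ?_⟩
  have hC0 : ENNReal.ofReal C ≠ 0 := by simpa using one_pos.trans_le hC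
  rw [mul_comm, ← ENNReal.le_div_iff_mul_le (Or.inl hC0) (Or.inl ENNReal.ofReal_ne_top)]
  refine sobolevNorm_le_of_tendsto h fun n => ?_
  rw [ENNReal.le_div_iff_mul_le (Or.inl hC0) (Or.inl ENNReal.ofReal_ne_top), mul_comm]
  exact (hp n).le

theorem of_coeff (hu : SobolevBound C s' u A) (hb : 0 ≤ b)
    (h : ∀ k, jap k ^ s * ‖coeff k v‖ ≤ b * (jap k ^ s' * ‖coeff k u‖)) :
    SobolevBound C s v (b * A) := by
  refine ⟨mul_nonneg hb hu.nonneg, ?_⟩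
  rw [ENNReal.ofReal_mul hb]
  calc _ ≤ ENNReal.ofReal C * (ENNReal.ofReal b * sobolevNorm s' u) := by
        gcongr
        exact sobolevNorm_le_of_coeff hb h
    _ = ENNReal.ofReal b * (ENNReal.ofReal C * sobolevNorm s' u) := by ring
    _ ≤ _ := by gcongr; exact hu.le

theorem of_coeff_loss (j : ℕ) (hu : SobolevBound C s' u A) (hs : s' = s + j) (hb : 0 ≤ b)
    (h : ∀ k, ‖coeff k v‖ ≤ b * jap k ^ j * ‖coeff k u‖) : SobolevBound C s v (b * A) :=
  hu.of_coeff hb fun k => by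
    have hj := Real.rpow_pos_of_pos (jap_pos k) s
    rw [hs, Real.rpow_add_natCast (jap_pos k).ne']
    calc _ ≤ jap k ^ s * (b * jap k ^ j * ‖coeff k u‖) := by gcongr; exact h k
      _ = _ := by ring

theorem of_coeff_gain (j : ℕ) (hu : SobolevBound C s' u A) (hs : s = s' + j) (hb : 0 ≤ b)
    (h : ∀ k, ‖coeff k v‖ * jap k ^ j ≤ b * ‖coeff k u‖) : SobolevBound C s v (b * A) :=
  hu.of_coeff hb fun k => by
    have hj := Real.rpow_pos_of_pos (jap_pos k) s'
    rw [hs, Real.rpow_add_natCast (jap_pos k).ne']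
    calc _ = jap k ^ s' * (‖coeff k v‖ * jap k ^ j) := by ring
      _ ≤ jap k ^ s' * (b * ‖coeff k u‖) := mul_le_mul_of_nonneg_left (h k) hj.le
      _ = _ := by ring

/-- A multiplier of order `j` loses `j` derivatives. -/
theorem fourierMul_loss {m : (Fin d → ℤ) → ℂ} (j : ℕ) (hu : SobolevBound C s' u A)
    (hs : s' = s + j) (hb : 0 ≤ b) (hm : ∀ k, ‖m k‖ ≤ b * jap k ^ j) :
    SobolevBound C s (fourierMul m u) (b * A) :=
  hu.of_coeff_loss j hs hb fun k => (norm_coeff_fourierMul_le m u k).trans <| by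
    rw [norm_mul]; gcongr; exact hm k

/-- A multiplier of order `-j` gains `j` derivatives. -/
theorem fourierMul_gain {m : (Fin d → ℤ) → ℂ} (j : ℕ) (hu : SobolevBound C s' u A)
    (hs : s = s' + j) (hb : 0 ≤ b) (hm : ∀ k, ‖m k‖ * jap k ^ j ≤ b) :
    SobolevBound C s (fourierMul m u) (b * A) :=
  hu.of_coeff_gain j hs hb fun k => by
    have hj := jap_pos k
    calc _ ≤ ‖m k * coeff k u‖ * jap k ^ j := by gcongr; exact norm_coeff_fourierMul_le m u k
      _ = ‖m k‖ * jap k ^ j * ‖coeff k u‖ := by rw [norm_mul]; ring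
      _ ≤ _ := by gcongr; exact hm k

theorem fourierMul {m : (Fin d → ℤ) → ℂ} (hu : SobolevBound C s u A) (hb : 0 ≤ b)
    (hm : ∀ k, ‖m k‖ ≤ b) : SobolevBound C s (fourierMul m u) (b * A) :=
  hu.fourierMul_loss 0 (by simp) hb fun k => by simpa using hm k

theorem fourierMul_contraction {m : (Fin d → ℤ) → ℂ} (hu : SobolevBound C s u A)
    (hm : ∀ k, ‖m k‖ ≤ 1) : SobolevBound C s (KleinGordon.fourierMul m u) A := by
  simpa using hu.fourierMul zero_le_one hm

/-- Estimating a difference of multipliers needs the exact coefficients, not only the inequality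
that survives a divergent series. They are available because `s > d/2` makes the series absolutely
convergent. -/
theorem coeff_fourierMul (hC : 1 ≤ C) (hs : (d : ℝ) / 2 < s) (hu : SobolevBound C s u A)
    {m : (Fin d → ℤ) → ℂ} (hm : ∀ k, ‖m k‖ ≤ 1) (k : Fin d → ℤ) :
    coeff k (KleinGordon.fourierMul m u) = m k * coeff k u := by
  have h := (summable_coeff hs (hu.ne_top hC)).norm
  refine KleinGordon.coeff_fourierMul (.of_norm (h.of_nonneg_of_le (fun _ => norm_nonneg _)
    fun k => ?_)) k
  rw [norm_mul]
  exact mul_le_of_le_one_left (norm_nonneg _) (hm k)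

/-- The difference of two multipliers, of order `j`. -/
theorem fourierMul_sub_fourierMul {m m' : (Fin d → ℤ) → ℂ} (j : ℕ) (hC : 1 ≤ C)
    (hlt : (d : ℝ) / 2 < s) (hu : SobolevBound C s' u A) (hs : s' = s + j) (hb : 0 ≤ b)
    (hm : ∀ k, ‖m k‖ ≤ 1) (hm' : ∀ k, ‖m' k‖ ≤ 1) (h : ∀ k, ‖m k - m' k‖ ≤ b * jap k ^ j) :
    SobolevBound C s (KleinGordon.fourierMul m u - KleinGordon.fourierMul m' u) (b * A) := by
  have hu' : SobolevBound C s u A := hu.anti (by rw [hs]; simp)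
  refine hu.of_coeff_loss j hs hb fun k => ?_
  rw [map_sub, hu'.coeff_fourierMul hC hlt hm, hu'.coeff_fourierMul hC hlt hm', ← sub_mul, norm_mul]
  gcongr
  exact h k

theorem fourierMul_sub_self {m : (Fin d → ℤ) → ℂ} (j : ℕ) (hC : 1 ≤ C)
    (hlt : (d : ℝ) / 2 < s) (hu : SobolevBound C s' u A) (hs : s' = s + j) (hb : 0 ≤ b)
    (hm : ∀ k, ‖m k‖ ≤ 1) (h : ∀ k, ‖m k - 1‖ ≤ b * jap k ^ j) :
    SobolevBound C s (KleinGordon.fourierMul m u - u) (b * A) := by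
  have hu' : SobolevBound C s u A := hu.anti (by rw [hs]; simp)
  refine hu.of_coeff_loss j hs hb fun k => ?_
  rw [map_sub, hu'.coeff_fourierMul hC hlt hm, ← sub_one_mul, norm_mul]
  gcongr
  exact h k

theorem fourierMul_sub_map {m : (Fin d → ℤ) → ℂ} (hC : 1 ≤ C)
    (hlt : (d : ℝ) / 2 < s) (hu : SobolevBound C s u A) (hv : SobolevBound C s v B)
    (hm : ∀ k, ‖m k‖ ≤ 1) {δ : ℝ} (h : SobolevBound C s (u - v) δ) :
    SobolevBound C s (KleinGordon.fourierMul m u - KleinGordon.fourierMul m v) δ := by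
  rw [← one_mul δ]
  refine h.of_coeff_loss 0 (by simp) zero_le_one fun k => ?_
  rw [map_sub, map_sub, hu.coeff_fourierMul hC hlt hm, hv.coeff_fourierMul hC hlt hm, ← mul_sub,
    norm_mul]
  simpa using mul_le_mul_of_nonneg_right (hm k) (norm_nonneg (coeff k u - coeff k v))

end SobolevBound

/-! ### The pointwise exponential and the nonlinear flow. -/

theorem exp_eq_expFn (g : Fn d) : NormedSpace.exp g = expFn g := by
  ext x
  have h := (NormedSpace.exp_series_hasSum_exp' (𝕂 := ℂ) g).mapL (ContinuousMap.evalCLM ℂ x)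
  have h' := NormedSpace.exp_series_hasSum_exp' (𝕂 := ℂ) (g x)
  rw [← Complex.exp_eq_exp_ℂ] at h'
  exact h.unique h'

theorem expFn_add (g h : Fn d) : expFn (g + h) = expFn g * expFn h := by
  ext x
  exact Complex.exp_add _ _

theorem sum_pow_div_factorial_le {G : ℝ} (hG : 0 ≤ G) (N : ℕ) :
    ∑ n ∈ Finset.range N, G ^ (n + 1) / (n + 1).factorial ≤ Real.exp G - 1 := by
  have h := Real.sum_le_exp_of_nonneg hG (N + 1)
  rw [Finset.sum_range_succ'] at h
  simp at h
  linarith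

namespace SobolevBound

variable {C s G V A B δ τ : ℝ} {g u v w : Fn d}

/-- The exponential series is bounded term by term in the algebra, and lower semicontinuity carries
the bound to its uniform limit. -/
theorem expFn_mul_sub_self (hC : IsAlgConst d C s) (hg : SobolevBound C s g G)
    (hv : SobolevBound C s v V) :
    SobolevBound C s (expFn g * v - v) ((Real.exp G - 1) * V) := by
  have h := (NormedSpace.exp_series_hasSum_exp' (𝕂 := ℂ) g).tendsto_sum_nat
  rw [exp_eq_expFn] at h
  -- The shift by one makes every partial sum contain the zeroth term `v`, which cancels against the
  -- subtracted `v`.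
  have h1 := ((h.comp (Filter.tendsto_add_atTop_nat 1)).mul_const v).sub_const v
  refine of_tendsto hC.one_le h1 fun N => ?_
  have h2 : SobolevBound C s (∑ n ∈ Finset.range N, ((n + 1).factorial⁻¹ : ℂ) • (g ^ (n + 1) * v))
      (∑ n ∈ Finset.range N, ((n + 1).factorial⁻¹ : ℝ) * (G ^ (n + 1) * V)) :=
    SobolevBound.sum fun n => ((hg.pow_succ hC n).mul hC hv).smul (by simp)
  have h3 : (∑ n ∈ Finset.range N, ((n + 1).factorial⁻¹ : ℝ) * (G ^ (n + 1) * V)) ≤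
      (Real.exp G - 1) * V := by
    have := mul_le_mul_of_nonneg_right (sum_pow_div_factorial_le hg.nonneg N) hv.nonneg
    refine le_trans (le_of_eq ?_) this
    rw [Finset.sum_mul]
    exact Finset.sum_congr rfl fun n _ => by ring
  convert mono h2 h3 using 1
  simp only [Function.comp_apply, Finset.sum_range_succ', add_mul, Finset.sum_mul, smul_mul_assoc]
  simp

/-- The exponent in the nonlinear flow. -/
theorem flow_exponent (h : SobolevBound C s w V) (hτ : 0 ≤ τ) :
    SobolevBound C s ((-(Complex.I * (τ : ℂ) * (3 / 8))) • w) (τ * (3 / 8) * V) :=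
  h.smul (by simp [abs_of_nonneg hτ])

/-- From `1 - y ≤ e^{-y}` one gets `e^y - 1 ≤ y e^y`, taken at `y = τ x` with `τ ≤ 1`. -/
theorem _root_.KleinGordon.exp_mul_sub_one_le {x : ℝ} (hx : 0 ≤ x) (hτ : 0 ≤ τ) (hτ1 : τ ≤ 1) :
    Real.exp (τ * x) - 1 ≤ τ * (x * Real.exp x) := by
  have h1 := Real.add_one_le_exp (-(τ * x))
  have h2 : Real.exp (τ * x) ≤ Real.exp x := Real.exp_le_exp.2 (by nlinarith)
  have h3 : Real.exp (-(τ * x)) * Real.exp (τ * x) = 1 := by rw [← Real.exp_add]; simp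
  have h4 := Real.exp_pos (τ * x)
  have h5 : 0 ≤ τ * x := by positivity
  nlinarith

theorem nonlinFlow_sub_self (hC : IsAlgConst d C s) (hu : SobolevBound C s u A) (hτ : 0 ≤ τ)
    (hτ1 : τ ≤ 1) :
    SobolevBound C s (nonlinFlow τ u - u)
      (τ * (3 / 8 * A ^ 2 * Real.exp (3 / 8 * A ^ 2) * A)) := by
  refine (((hu.absSq hC).flow_exponent hτ).expFn_mul_sub_self hC hu).mono ?_
  have hA := hu.nonneg
  calc _ ≤ (τ * (3 / 8 * A ^ 2 * Real.exp (3 / 8 * A ^ 2))) * A := by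
        gcongr
        rw [mul_assoc]
        exact exp_mul_sub_one_le (by positivity) hτ hτ1
    _ = _ := by ring

theorem absSq_sub_absSq (hC : IsAlgConst d C s) (hu : SobolevBound C s u A)
    (hw : SobolevBound C s w A) (h : SobolevBound C s (u - w) δ) :
    SobolevBound C s (KleinGordon.absSq u - KleinGordon.absSq w) (2 * A * δ) := by
  have h1 := (hu.mul hC h.star).add (h.mul hC hw.star)
  have h2 : u * star (u - w) + (u - w) * star w = KleinGordon.absSq u - KleinGordon.absSq w := by
    rw [star_sub, KleinGordon.absSq, KleinGordon.absSq]; ring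
  rw [h2] at h1
  exact h1.mono (by linarith)

/-- The Lipschitz rate of the nonlinear flow on the ball of radius `A`. -/
def _root_.KleinGordon.flowRate (A : ℝ) : ℝ :=
  3 / 8 * A ^ 2 * Real.exp (3 / 8 * A ^ 2) +
    3 / 4 * A ^ 2 * Real.exp (3 / 2 * A ^ 2) * Real.exp (3 / 8 * A ^ 2)

theorem nonlinFlow_sub_nonlinFlow (hC : IsAlgConst d C s) (hu : SobolevBound C s u A)
    (hw : SobolevBound C s w A) (h : SobolevBound C s (u - w) δ) (hτ : 0 ≤ τ) (hτ1 : τ ≤ 1) :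
    SobolevBound C s (nonlinFlow τ u - nonlinFlow τ w) ((1 + τ * flowRate A) * δ) := by
  have hA := hu.nonneg
  -- The triangle inequality always provides the radius `2 * A`. With `δ` below it, exponentials of
  -- `A * δ` are bounded by constants depending on `A` alone, and the estimate stays linear in `δ`.
  wlog hδ : δ ≤ 2 * A generalizing δ
  · refine (this ((hu.sub hw).mono (two_mul A).ge) le_rfl).mono ?_
    have : 0 ≤ flowRate A := by unfold flowRate; positivity
    gcongr
    exact (not_le.1 hδ).le
  have hδ0 := h.nonneg
  have hg := (hu.absSq hC).flow_exponent hτ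
  have hh := (hw.absSq hC).flow_exponent hτ
  have hgh := (hu.absSq_sub_absSq hC hw h).flow_exponent hτ
  set g := (-(Complex.I * (τ : ℂ) * (3 / 8))) • KleinGordon.absSq u with hgdef
  set k := (-(Complex.I * (τ : ℂ) * (3 / 8))) • KleinGordon.absSq w with hkdef
  rw [smul_sub, ← hgdef, ← hkdef] at hgh
  have e1 := hg.expFn_mul_sub_self hC h
  have e2 : SobolevBound C s (expFn k * w) (Real.exp (τ * (3 / 8) * A ^ 2) * A) := by
    have := (hh.expFn_mul_sub_self hC hw).add hw
    rw [sub_add_cancel] at this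
    exact this.mono (by linarith)
  have e3 := hgh.expFn_mul_sub_self hC e2
  have e4 := (e1.add h).add e3
  -- Splitting `e^g u - e^k w = e^g (u - w) + (e^{g-k} - 1) e^k w`.
  have heq : expFn g * (u - w) - (u - w) + (u - w) + (expFn (g - k) * (expFn k * w) - expFn k * w) =
      nonlinFlow τ u - nonlinFlow τ w := by
    rw [← mul_assoc, ← expFn_add, sub_add_cancel]
    change _ = expFn g * u - expFn k * w
    rw [sub_add_cancel, mul_sub, sub_add_sub_cancel]
  rw [heq] at e4
  refine e4.mono ?_
  have b1 : Real.exp (τ * (3 / 8) * A ^ 2) - 1 ≤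
      τ * (3 / 8 * A ^ 2 * Real.exp (3 / 8 * A ^ 2)) := by
    rw [mul_assoc]; exact exp_mul_sub_one_le (by positivity) hτ hτ1
  have b2 : Real.exp (τ * (3 / 8) * (2 * A * δ)) - 1 ≤
      τ * (3 / 4 * A * δ * Real.exp (3 / 2 * A ^ 2)) := by
    rw [show τ * (3 / 8) * (2 * A * δ) = τ * (3 / 4 * A * δ) by ring]
    refine (exp_mul_sub_one_le (by positivity) hτ hτ1).trans ?_
    exact mul_le_mul_of_nonneg_left (mul_le_mul_of_nonneg_left (Real.exp_le_exp.2 (by nlinarith))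
      (by positivity)) hτ
  have b3 : Real.exp (τ * (3 / 8) * A ^ 2) ≤ Real.exp (3 / 8 * A ^ 2) := by
    refine Real.exp_le_exp.2 ?_
    nlinarith [sq_nonneg A]
  calc _ ≤ τ * (3 / 8 * A ^ 2 * Real.exp (3 / 8 * A ^ 2)) * δ + δ +
        τ * (3 / 4 * A * δ * Real.exp (3 / 2 * A ^ 2)) * (Real.exp (3 / 8 * A ^ 2) * A) := by
        gcongr
    _ = _ := by unfold flowRate; ring

end SobolevBound

/-! ### Bounds for the phases and the functions `φ₁`, `φ₂`. -/

theorem norm_phase (a : ℝ) : ‖phase a‖ = 1 := by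
  rw [phase, mul_comm, Complex.norm_exp_ofReal_mul_I]

theorem norm_exp_I_mul (a : ℝ) : ‖Complex.exp (Complex.I * a)‖ = 1 := norm_phase a

theorem norm_exp_I_mul_sub_le (a b : ℝ) :
    ‖Complex.exp (Complex.I * a) - Complex.exp (Complex.I * b)‖ ≤ |a - b| := by
  have h : Complex.exp (Complex.I * a) - Complex.exp (Complex.I * b) =
      Complex.exp (Complex.I * b) * (Complex.exp (Complex.I * (a - b : ℝ)) - 1) := by
    rw [mul_sub, ← Complex.exp_add, mul_one]
    congr 2
    push_cast; ring
  rw [h, norm_mul, norm_exp_I_mul, one_mul]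
  exact Real.norm_exp_I_mul_ofReal_sub_one_le

theorem norm_phi1_le_one (x : ℝ) : ‖phi1 (Complex.I * x)‖ ≤ 1 := by
  unfold phi1
  split_ifs with h
  · simp
  · have hx : x ≠ 0 := fun h0 => h (by simp [h0])
    rw [norm_div, norm_mul, Complex.norm_I, one_mul, Complex.norm_real]
    exact div_le_one_of_le₀ Real.norm_exp_I_mul_ofReal_sub_one_le (norm_nonneg _)

/-- On the imaginary axis the numerator stays bounded, so `φ₁` decays like the inverse of its
argument. This decay is the source of every gain from oscillation. -/
theorem norm_phi1_mul_le (x : ℝ) : ‖phi1 (Complex.I * x)‖ * |x| ≤ 2 := by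
  unfold phi1
  split_ifs with h
  · have hx : x = 0 := by simpa using h
    simp [hx]
  · have hx : x ≠ 0 := fun h0 => h (by simp [h0])
    rw [norm_div, norm_mul, Complex.norm_I, one_mul, Complex.norm_real, Real.norm_eq_abs,
      div_mul_cancel₀ _ (abs_ne_zero.2 hx)]
    refine (norm_sub_le _ _).trans ?_
    rw [norm_exp_I_mul]; norm_num

theorem norm_phi2_mul_le (x : ℝ) : ‖phi2 (Complex.I * x)‖ * |x| ≤ 2 := by
  unfold phi2
  split_ifs with h
  · have hx : x = 0 := by simpa using h
    simp [hx]
  · have hx : x ≠ 0 := fun h0 => h (by simp [h0])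
    rw [norm_div, norm_mul, Complex.norm_I, one_mul, Complex.norm_real, Real.norm_eq_abs,
      div_mul_cancel₀ _ (abs_ne_zero.2 hx)]
    refine (norm_sub_le _ _).trans ?_
    rw [norm_exp_I_mul]
    linarith [norm_phi1_le_one x]

/-! ### The symbols of `𝒜_c` and `J_c` as `c` grows. -/

section Symbols

variable {c : ℝ}

theorem bracketSym_sq (c : ℝ) (k : Fin d → ℤ) : bracketSym c k ^ 2 = c ^ 2 + normSq k :=
  Real.sq_sqrt (by nlinarith [normSq_nonneg k])

theorem le_bracketSym (c : ℝ) (k : Fin d → ℤ) : c ≤ bracketSym c k :=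
  Real.le_sqrt_of_sq_le (by linarith [normSq_nonneg k])

theorem jap_le_bracketSym (hc : 1 ≤ c) (k : Fin d → ℤ) : jap k ≤ bracketSym c k :=
  Real.sqrt_le_sqrt (by nlinarith)

theorem bracketSym_sub_le (hc : 1 ≤ c) (k : Fin d → ℤ) : bracketSym c k - c ≤ jap k := by
  have h := bracketSym_sq c k
  have h1 := jap_sq k
  have h2 := le_bracketSym c k
  have h3 := jap_pos k
  nlinarith

theorem symA_nonneg (hc : 1 ≤ c) (k : Fin d → ℤ) : 0 ≤ symA c k := by
  have := le_bracketSym c k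
  unfold symA; nlinarith

theorem symA_le_mul_jap (hc : 1 ≤ c) (k : Fin d → ℤ) : symA c k ≤ c * jap k := by
  have := bracketSym_sub_le hc k
  unfold symA; nlinarith

/-- With `b = bracketSym c k`, both `symA c k = c (b - c)` and `normSq k = (b - c) (b + c)` hold. -/
theorem half_sub_symA (c : ℝ) (k : Fin d → ℤ) : normSq k / 2 - symA c k = (bracketSym c k - c) ^ 2 / 2 := by
  have h := bracketSym_sq c k
  unfold symA; nlinarith

theorem symA_le (c : ℝ) (k : Fin d → ℤ) : symA c k ≤ normSq k / 2 := by
  have := half_sub_symA c k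
  nlinarith [sq_nonneg (bracketSym c k - c)]

/-- In `(b - c)² / 2`, with `b = bracketSym c k`, one factor `b - c` is at most `jap k` and the
other, multiplied by `c`, is `symA c k ≤ jap k ^ 2`. Hence one power of `c⁻¹` costs three
derivatives. -/
theorem abs_symA_sub_le (hc : 1 ≤ c) (k : Fin d → ℤ) : |symA c k - normSq k / 2| ≤ c⁻¹ * jap k ^ 3 := by
  have h0 := half_sub_symA c k
  have h1 := symA_nonneg hc k
  have h2 := symA_le c k
  have h3 := bracketSym_sub_le hc k
  have h4 := le_bracketSym c k
  have h5 := jap_sq k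
  have h6 := jap_pos k
  have h7 : symA c k = c * (bracketSym c k - c) := by unfold symA; ring
  rw [abs_sub_comm, h0, abs_of_nonneg (by positivity), inv_mul_eq_div, le_div_iff₀ (by linarith)]
  have h8 : c * (bracketSym c k - c) ≤ jap k ^ 2 := by linarith [normSq_nonneg k]
  calc _ = (c * (bracketSym c k - c)) * (bracketSym c k - c) / 2 := by ring
    _ ≤ jap k ^ 2 * jap k / 2 := by
        have := mul_le_mul h8 h3 (by linarith) (by positivity)
        linarith
    _ ≤ jap k ^ 3 := by
        have : 0 < jap k ^ 3 := by positivity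
        nlinarith

theorem norm_symJ_le_one (hc : 1 ≤ c) (k : Fin d → ℤ) : ‖((c / bracketSym c k : ℝ) : ℂ)‖ ≤ 1 := by
  have h := le_bracketSym c k
  have hc0 : 0 < c := by linarith
  rw [Complex.norm_real, Real.norm_eq_abs, abs_of_nonneg (div_nonneg hc0.le (hc0.trans_le h).le)]
  exact div_le_one_of_le₀ h (by linarith)

theorem norm_symJ_sub_one_le (hc : 1 ≤ c) (k : Fin d → ℤ) : ‖((c / bracketSym c k : ℝ) : ℂ) - 1‖ ≤ c⁻¹ * jap k := by
  have h := le_bracketSym c k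
  have h1 := bracketSym_sub_le hc k
  have hc0 : 0 < c := by linarith
  have hb : 0 < bracketSym c k := by linarith
  rw [← Complex.ofReal_one, ← Complex.ofReal_sub, Complex.norm_real, Real.norm_eq_abs, abs_sub_comm,
    abs_of_nonneg (sub_nonneg.2 (div_le_one_of_le₀ h hb.le))]
  rw [one_sub_div hb.ne', inv_mul_eq_div]
  exact div_le_div₀ (jap_pos k).le h1 hc0 h

end Symbols

/-! ### The regime `τc ≥ 1` and the oscillation rate `(τc²)⁻¹`. -/

/-- Step sizes `τ ≤ 1` which do not resolve the time scale `c⁻¹`. -/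
structure Unresolved (c τ : ℝ) : Prop where
  pos : 0 < τ
  le_one : τ ≤ 1
  one_le_mul : 1 ≤ τ * c

namespace Unresolved

variable {c τ : ℝ} (h : Unresolved c τ)

theorem one_le (h : Unresolved c τ) : 1 ≤ c := by
  have h1 := h.pos
  have h2 := h.le_one
  have h3 := h.one_le_mul
  by_contra! hc
  nlinarith

theorem c_pos (h : Unresolved c τ) : 0 < c := one_pos.trans_le h.one_le

theorem rate_nonneg (h : Unresolved c τ) : 0 ≤ (τ * c ^ 2)⁻¹ := by
  have := h.pos
  positivity

/-- The left side is `c⁻²`, and the inequality is `1 ≤ τc` divided by `c²`. -/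
theorem mul_rate_le (h : Unresolved c τ) : τ * (τ * c ^ 2)⁻¹ ≤ τ * c⁻¹ := by
  have h1 := h.pos
  have h2 := h.c_pos
  have h3 := h.one_le_mul
  gcongr
  nlinarith

theorem rate_le (h : Unresolved c τ) : (τ * c ^ 2)⁻¹ ≤ c⁻¹ / τ := by
  have h1 := h.pos
  have h2 := h.c_pos
  have h3 := h.one_le
  rw [← one_div, div_le_div_iff₀ (by positivity) h1, sq]
  field_simp
  exact h3

theorem sq_mul_rate_le (h : Unresolved c τ) : τ ^ 2 * (τ * c ^ 2)⁻¹ ≤ τ * c⁻¹ := by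
  have h1 := h.pos
  calc _ = τ * (τ * (τ * c ^ 2)⁻¹) := by ring
    _ ≤ 1 * (τ * c⁻¹) := by
      have := h.mul_rate_le
      have h0 := h.rate_nonneg
      gcongr
      exact h.le_one
    _ = _ := one_mul _

theorem norm_le_rate {a : ℂ} {x : ℝ} (h : Unresolved c τ) (ha : ‖a‖ * |τ * x| ≤ 2)
    (hx : 2 * c ^ 2 ≤ |x|) : ‖a‖ ≤ (τ * c ^ 2)⁻¹ := by
  have h1 := h.pos
  have h2 := h.c_pos
  rw [abs_mul, abs_of_pos h1] at ha
  rw [← one_div, le_div_iff₀ (by positivity)]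
  have h3 : ‖a‖ * (τ * (2 * c ^ 2)) ≤ ‖a‖ * (τ * |x|) := by gcongr
  linarith

theorem norm_div_le_rate {a b D : ℂ} (h : Unresolved c τ) (ha : ‖a‖ ≤ 1) (hb : ‖b‖ ≤ 1)
    (hD : 2 * (τ * c ^ 2) ≤ ‖D‖) : ‖(a - b) / D‖ ≤ (τ * c ^ 2)⁻¹ := by
  have h1 := h.pos
  have h2 := h.c_pos
  have h3 : 0 < τ * c ^ 2 := by positivity
  rw [norm_div, ← one_div, div_le_div_iff₀ (by linarith) h3]
  have h4 : ‖a - b‖ ≤ 2 := (norm_sub_le _ _).trans (by linarith)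
  nlinarith

theorem norm_phi2_le_rate (h : Unresolved c τ) {z : ℂ} (δ : ℝ) (hδ : 2 ≤ |δ|)
    (hz : z = Complex.I * (τ * (δ * c ^ 2) : ℝ)) : ‖phi2 z‖ ≤ (τ * c ^ 2)⁻¹ := by
  refine h.norm_le_rate (hz ▸ norm_phi2_mul_le _) ?_
  rw [abs_mul, abs_of_nonneg (sq_nonneg c)]
  gcongr

end Unresolved

theorem norm_phi1_le_one' {z : ℂ} (x : ℝ) (hz : z = Complex.I * x) : ‖phi1 z‖ ≤ 1 :=
  hz ▸ norm_phi1_le_one x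

/-! ### The operators of the scheme in Sobolev norms. -/

namespace SobolevBound

variable {C s s' A M c τ t δ : ℝ} {u w : Fn d}

theorem expA (hu : SobolevBound C s u A) (c t : ℝ) : SobolevBound C s (expA c t u) A :=
  hu.fourierMul_contraction fun _ => (norm_exp_I_mul _).le

theorem schroedinger (hu : SobolevBound C s u A) (t : ℝ) :
    SobolevBound C s (schroedinger t u) A :=
  hu.fourierMul_contraction fun _ => (norm_exp_I_mul _).le

theorem opJ (hu : SobolevBound C s u A) (hc : 1 ≤ c) : SobolevBound C s (opJ c u) A :=
  hu.fourierMul_contraction fun k => norm_symJ_le_one hc k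

theorem opJ_sub_self (hC : IsAlgConst d C s) (hu : SobolevBound C (s + 1) u A) (hc : 1 ≤ c) :
    SobolevBound C s (KleinGordon.opJ c u - u) (c⁻¹ * A) :=
  hu.fourierMul_sub_self 1 hC.one_le hC.lt (by simp) (by positivity)
    (fun k => norm_symJ_le_one hc k) fun k => by simpa using norm_symJ_sub_one_le hc k

theorem expA_sub_schroedinger (hC : IsAlgConst d C s) (hu : SobolevBound C (s + 3) u A)
    (hc : 1 ≤ c) (ht : 0 ≤ t) :
    SobolevBound C s (KleinGordon.expA c t u - KleinGordon.schroedinger t u) (t * c⁻¹ * A) :=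
  hu.fourierMul_sub_fourierMul 3 hC.one_le hC.lt (by norm_num) (by positivity)
    (fun _ => (norm_exp_I_mul _).le) (fun _ => (norm_exp_I_mul _).le) fun k => by
      refine (norm_exp_I_mul_sub_le _ _).trans ?_
      rw [← mul_sub, abs_mul, abs_of_nonneg ht, mul_assoc]
      gcongr
      exact abs_symA_sub_le hc k

/-- This bound and `opA_two` are the two faces of `𝒜_c`: order one with norm growing like `c`, or
order two uniformly in `c`. Stability uses the first in the non-resonant brackets, consistency the
second. -/
theorem opA_one (hu : SobolevBound C (s + 1) u A) (hc : 1 ≤ c) :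
    SobolevBound C s (opA c u) (c * A) :=
  hu.fourierMul_loss 1 (by simp) (by positivity) fun k => by
    rw [Complex.norm_real, Real.norm_eq_abs, abs_of_nonneg (symA_nonneg hc k), pow_one]
    exact symA_le_mul_jap hc k

theorem opA_two (hu : SobolevBound C (s + 2) u A) (hc : 1 ≤ c) :
    SobolevBound C s (opA c u) A := by
  rw [← one_mul A]
  refine hu.fourierMul_loss 2 (by simp) zero_le_one fun k => ?_
  rw [Complex.norm_real, Real.norm_eq_abs, abs_of_nonneg (symA_nonneg hc k), one_mul, jap_sq]
  linarith [symA_le c k, normSq_nonneg k]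

theorem halfLapSubA (hu : SobolevBound C (s + 2) u A) (hc : 1 ≤ c) :
    SobolevBound C s (halfLapSubA c u) A := by
  rw [← one_mul A]
  refine hu.fourierMul_loss 2 (by simp) zero_le_one fun k => ?_
  have h1 := symA_le c k
  have h2 := symA_nonneg hc k
  have h3 := normSq_nonneg k
  rw [Complex.norm_real, Real.norm_eq_abs, one_mul, jap_sq, abs_le]
  constructor <;> linarith

theorem phiRes (hu : SobolevBound C s u A) (h : Unresolved c τ) {φ : ℂ → ℂ}
    (hφ : ∀ x : ℝ, ‖φ (Complex.I * x)‖ * |x| ≤ 2) :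
    SobolevBound C s (phiRes φ c τ u) ((τ * c ^ 2)⁻¹ * A) :=
  hu.fourierMul h.rate_nonneg fun k => by
    refine h.norm_le_rate (hφ _) ?_
    have := normSq_nonneg k
    rw [abs_of_nonneg (by positivity)]
    linarith

/-- Twice `2c² + |k|²/2` dominates `1 + |k|²`, so the decay of `φ` recovers two derivatives at cost
`1/τ`. -/
theorem phiRes_gain (hu : SobolevBound C s u A) (h : Unresolved c τ) {φ : ℂ → ℂ}
    (hφ : ∀ x : ℝ, ‖φ (Complex.I * x)‖ * |x| ≤ 2) :
    SobolevBound C (s + 2) (KleinGordon.phiRes φ c τ u) (4 / τ * A) := by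
  have hτ := h.pos
  refine hu.fourierMul_gain 2 (by simp) (by positivity) fun k => ?_
  have h0 := hφ (τ * (2 * c ^ 2 + normSq k / 2))
  have h1 := normSq_nonneg k
  have h2 := h.one_le
  rw [abs_of_nonneg (by positivity)] at h0
  rw [le_div_iff₀ hτ, jap_sq]
  set a := ‖φ (Complex.I * (τ * (2 * c ^ 2 + normSq k / 2) : ℝ))‖
  have ha : 0 ≤ a * τ := mul_nonneg (norm_nonneg _) hτ.le
  have h3 : 1 + normSq k ≤ 2 * (2 * c ^ 2 + normSq k / 2) := by nlinarith
  nlinarith [mul_le_mul_of_nonneg_left h3 ha]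

/-- Both `δ c²` and `-𝒜_c` are nonpositive, so they cannot cancel. -/
theorem le_abs_nonres (hc : 1 ≤ c) (hδ : δ ≤ -2) (k : Fin d → ℤ) :
    2 * c ^ 2 + symA c k ≤ |δ * c ^ 2 - symA c k| := by
  have h1 := symA_nonneg hc k
  rw [abs_of_nonpos (by nlinarith)]
  nlinarith

theorem phiNonRes (hu : SobolevBound C s u A) (h : Unresolved c τ) {φ : ℂ → ℂ}
    (hφ : ∀ x : ℝ, ‖φ (Complex.I * x)‖ * |x| ≤ 2) (hδ : δ ≤ -2) :
    SobolevBound C s (phiNonRes φ c τ δ u) ((τ * c ^ 2)⁻¹ * A) :=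
  hu.fourierMul h.rate_nonneg fun k => by
    refine h.norm_le_rate (hφ _) ?_
    linarith [le_abs_nonres h.one_le hδ k, symA_nonneg h.one_le k]

/-- The denominator is at least `2c² + symA c k = c² + c * bracketSym c k ≥ c * jap k`. The factor
`1/c` compensates the `c` of `opA_one`. -/
theorem phiNonRes_gain (hu : SobolevBound C s u A) (h : Unresolved c τ) {φ : ℂ → ℂ}
    (hφ : ∀ x : ℝ, ‖φ (Complex.I * x)‖ * |x| ≤ 2) (hδ : δ ≤ -2) :
    SobolevBound C (s + 1) (KleinGordon.phiNonRes φ c τ δ u) (2 / (τ * c) * A) := by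
  have hτ := h.pos
  have hc := h.c_pos
  refine hu.fourierMul_gain 1 (by simp) (by positivity) fun k => ?_
  have h0 := hφ (τ * (δ * c ^ 2 - symA c k))
  have h1 := le_abs_nonres h.one_le hδ k
  have h2 := jap_le_bracketSym h.one_le k
  rw [abs_mul, abs_of_pos hτ] at h0
  rw [le_div_iff₀ (by positivity), pow_one]
  set a := ‖φ (Complex.I * (τ * (δ * c ^ 2 - symA c k) : ℝ))‖
  have ha : 0 ≤ a * τ := mul_nonneg (norm_nonneg _) hτ.le
  have h3 : c * jap k ≤ |δ * c ^ 2 - symA c k| := by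
    refine le_trans ?_ h1
    unfold symA
    nlinarith
  nlinarith [mul_le_mul_of_nonneg_left h3 ha]

/-- Common shape of `vartheta` and `Omega`; the `5` is `1 + 3 + 1`. -/
theorem cubic_combination (hC : IsAlgConst d C s) (hu : SobolevBound C s u M) {a₁ a₂ a₃ : ℂ} {q : ℝ}
    {p₁ p₂ p₃ : ℂ} (hp₁ : ‖p₁‖ = 1) (hp₂ : ‖p₂‖ = 1) (hp₃ : ‖p₃‖ = 1) (h₁ : ‖a₁‖ ≤ q) (h₂ : ‖a₂‖ ≤ q)
    (h₃ : ‖a₃‖ ≤ q) :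
    SobolevBound C s ((p₁ * a₁) • u ^ 3 + (3 * p₂ * a₂) • (KleinGordon.absSq u * star u)
      + (p₃ * a₃) • (star u) ^ 3) (5 * q * M ^ 3) := by
  have e1 := (hu.cube hC).smul (a := p₁ * a₁) (b := q) (by rwa [norm_mul, hp₁, one_mul])
  have e2 := (hu.absSq_mul_star hC).smul (a := 3 * p₂ * a₂) (b := 3 * q) (by
    rw [norm_mul, norm_mul, hp₂]; norm_num; exact h₂)
  have e3 := (hu.star.cube hC).smul (a := p₃ * a₃) (b := q) (by rwa [norm_mul, hp₃, one_mul])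
  exact ((e1.add e2).add e3).mono (by linarith)

theorem vartheta (hC : IsAlgConst d C s) (hu : SobolevBound C s u M) (h : Unresolved c τ) (t : ℝ) :
    SobolevBound C s (vartheta c t τ u) (5 * (τ * c ^ 2)⁻¹ * M ^ 3) := by
  have h1 := h.pos
  have h3 : 0 < τ * c ^ 2 := by have := h.c_pos; positivity
  refine cubic_combination hC hu (norm_phase _) (norm_phase _) (norm_phase _)
    (h.norm_div_le_rate (norm_phi1_le_one' (2 * c ^ 2 * τ) ?_) (by simp) ?_)
    (h.norm_div_le_rate (norm_phi1_le_one' (-2 * c ^ 2 * τ) ?_) (by simp) ?_)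
    (h.norm_div_le_rate (norm_phi1_le_one' (-4 * c ^ 2 * τ) ?_) (by simp) ?_)
  all_goals first
    | (push_cast; ring1)
    | (simp [abs_of_pos h1]; linarith)

theorem Omega (hC : IsAlgConst d C s) (hu : SobolevBound C s u M) (h : Unresolved c τ) (l : ℤ)
    (t : ℝ) : SobolevBound C s (Omega c l t τ u) (5 * (τ * c ^ 2)⁻¹ * M ^ 3) := by
  have h1 := h.pos
  have h3 : 0 < τ * c ^ 2 := by have := h.c_pos; positivity
  have hl : ‖phi1 ((l : ℂ) * Complex.I * c ^ 2 * τ)‖ ≤ 1 :=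
    norm_phi1_le_one' (l * c ^ 2 * τ) (by push_cast; ring)
  refine cubic_combination hC hu (norm_phase _) (norm_phase _) (norm_phase _)
    (h.norm_div_le_rate (norm_phi1_le_one' ((l + 2) * c ^ 2 * τ) ?_) hl ?_)
    (h.norm_div_le_rate (norm_phi1_le_one' ((l - 2) * c ^ 2 * τ) ?_) hl ?_)
    (h.norm_div_le_rate (norm_phi1_le_one' ((l - 4) * c ^ 2 * τ) ?_) hl ?_)
  all_goals first
    | (push_cast; ring1)
    | (simp [abs_of_pos h1]; linarith)

end SobolevBound

/-! ### Stability and consistency of one step. -/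

/-- The argument of the resonant `φ₂` in the oscillatory term. -/
def resBracket (c : ℝ) (u : Fn d) : Fn d := halfLapSubA c (u ^ 3) + 3 * u ^ 2 * opA c u

/-- The argument of the first non-resonant `φ₂` in the oscillatory term. -/
def nonresBracket (c : ℝ) (u : Fn d) : Fn d :=
  (star u) ^ 2 * opA c u - 2 * absSq u * opA c (star u)

/-- The argument of the second non-resonant `φ₂` in the oscillatory term. -/
def conjBracket (c : ℝ) (u : Fn d) : Fn d := 3 * (star u) ^ 2 * opA c (star u)

namespace SobolevBound

variable {C s s₁ s' A B M c τ e : ℝ} {u w : Fn d}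

theorem resBracket (hC : IsAlgConst d C s) (hC' : IsAlgConst d C (s + 2))
    (hu : SobolevBound C (s + 2) u M) (hc : 1 ≤ c) :
    SobolevBound C s (resBracket c u) (4 * M ^ 3) := by
  have hu' : SobolevBound C s u M := hu.anti (by linarith)
  have h1 := ((hu.cube hC').halfLapSubA hc).add
    (((hu'.sq hC).ofNat_three_mul).mul hC (hu.opA_two hc))
  exact h1.mono (by linarith)

theorem nonresBracket (hC : IsAlgConst d C s) (hu : SobolevBound C s u M)
    (hA : SobolevBound C s (opA c u) B) (hA' : SobolevBound C s (opA c (star u)) B) :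
    SobolevBound C s (nonresBracket c u) (3 * M ^ 2 * B) := by
  have h1 := ((hu.star.sq hC).mul hC hA).sub (((hu.absSq hC).ofNat_two_mul).mul hC hA')
  exact h1.mono (by linarith)

theorem conjBracket (hC : IsAlgConst d C s) (hu : SobolevBound C s u M)
    (hA : SobolevBound C s (opA c (star u)) B) :
    SobolevBound C s (conjBracket c u) (3 * M ^ 2 * B) :=
  (((hu.star.sq hC).ofNat_three_mul).mul hC hA).mono (by linarith)

theorem rate_term (h : Unresolved c τ) (he : c⁻¹ ≤ e) {a : ℂ} {x : ℝ} (hx : 0 ≤ x)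
    (hw : SobolevBound C s w ((τ * c ^ 2)⁻¹ * A)) (hA : 0 ≤ A) (ha : ‖a‖ ≤ x * τ) :
    SobolevBound C s (a • w) (τ * e * (x * A)) := by
  have h1 := h.mul_rate_le
  have h2 := h.pos
  refine (hw.smul ha).mono ?_
  calc _ = (τ * (τ * c ^ 2)⁻¹) * (x * A) := by ring
    _ ≤ (τ * c⁻¹) * (x * A) := by gcongr
    _ ≤ _ := by gcongr

theorem sq_rate_term (h : Unresolved c τ) (he : c⁻¹ ≤ e) {a : ℂ} {x : ℝ} (hx : 0 ≤ x)
    (hw : SobolevBound C s w ((τ * c ^ 2)⁻¹ * A)) (hA : 0 ≤ A) (ha : ‖a‖ ≤ x * τ ^ 2) :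
    SobolevBound C s (a • w) (τ * e * (x * A)) := by
  have h1 := h.sq_mul_rate_le
  have h2 := h.pos
  refine (hw.smul ha).mono ?_
  calc _ = (τ ^ 2 * (τ * c ^ 2)⁻¹) * (x * A) := by ring
    _ ≤ (τ * c⁻¹) * (x * A) := by gcongr
    _ ≤ _ := by gcongr

theorem div_term (h : Unresolved c τ) {a : ℂ} {x : ℝ}
    (hw : SobolevBound C s w (e / τ * A)) (ha : ‖a‖ ≤ x * τ ^ 2) :
    SobolevBound C s (a • w) (τ * e * (x * A)) := by
  have h2 := h.pos
  refine (hw.smul ha).mono (le_of_eq ?_)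
  field_simp

theorem phi2_add (hw : SobolevBound C s w A) {v : Fn d} {q : ℝ} {a : ℂ} (ha : ‖a‖ ≤ q)
    (hv : SobolevBound C s v (5 * q * A)) : SobolevBound C s ((3 * a) • w + v) (q * (8 * A)) :=
  ((hw.smul (a := 3 * a) (b := 3 * q) (by rw [norm_mul]; norm_num; exact ha)).add hv).mono
    (by linarith)

theorem OmegaBar (hC : IsAlgConst d C s) (hu : SobolevBound C s u M) (h : Unresolved c τ) (σ l : ℤ)
    (t : ℝ) : SobolevBound C s (OmegaBar σ c l t τ u) (5 * (τ * c ^ 2)⁻¹ * M ^ 3) :=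
  (hu.Omega hC h (σ * l) t).star

/-- The three `φ₂` terms containing `𝒜_c` enter as hypotheses because stability and consistency
bound them by different routes. The coefficient of `M ^ 3` is `1 + 16 + 3 + 18 + 1 + 6`; that of `M
^ 5` is `8` times `3/8 + 3/8 + 6/8 + 3/8`. -/
theorem oscTerm (hC : IsAlgConst d C s) (hu : SobolevBound C s u M) (h : Unresolved c τ) (σ : ℤ)
    (t : ℝ) (he : c⁻¹ ≤ e)
    (h2 : SobolevBound C s (KleinGordon.phiRes phi2 c τ (KleinGordon.resBracket c u)) (e / τ * (16 * M ^ 3)))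
    (h4 : SobolevBound C s (KleinGordon.phiNonRes phi2 c τ (-2) (KleinGordon.nonresBracket c u))
      (e / τ * (6 * M ^ 3)))
    (h6 : SobolevBound C s (KleinGordon.phiNonRes phi2 c τ (-4) (KleinGordon.conjBracket c u))
      (e / τ * (6 * M ^ 3))) :
    SobolevBound C s (oscTerm σ c τ t u) (τ * e * (45 * M ^ 3 + 15 * M ^ 5)) := by
  have hM := hu.nonneg
  have hM3 : 0 ≤ M ^ 3 := by positivity
  have hτ := h.pos
  have hc := h.one_le
  have hM5 : 0 ≤ M ^ 2 * (8 * M ^ 3) := by positivity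
  have hpos : ∀ x : ℝ, ‖phase x‖ = 1 := norm_phase
  have e1 := rate_term (a := (τ : ℂ) * phase (2 * c ^ 2 * t)) h he zero_le_one
    (((hu.cube hC).phiRes h norm_phi1_mul_le).expA c τ) hM3 (by simp [hpos, abs_of_pos hτ])
  have e2 := div_term (a := Complex.I * (τ : ℂ) ^ 2 * phase (2 * c ^ 2 * t)) (x := 1) h
    (h2.expA c τ) (by simp [hpos])
  have e3 := rate_term (a := 3 * (τ : ℂ) * phase (-2 * c ^ 2 * t)) (x := 3) h he (by norm_num)
    (((hu.absSq_mul_star hC).phiNonRes h norm_phi1_mul_le le_rfl).expA c τ) hM3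
    (by simp [hpos, abs_of_pos hτ])
  have e4 := div_term (a := 3 * Complex.I * (τ : ℂ) ^ 2 * phase (-2 * c ^ 2 * t)) (x := 3) h
    (h4.expA c τ) (by simp [hpos])
  have e5 := rate_term (a := (τ : ℂ) * phase (-4 * c ^ 2 * t)) h he zero_le_one
    (((hu.star.cube hC).phiNonRes h norm_phi1_mul_le (δ := -4) (by norm_num)).expA c τ) hM3
    (by simp [hpos, abs_of_pos hτ])
  have e6 := div_term (a := Complex.I * (τ : ℂ) ^ 2 * phase (-4 * c ^ 2 * t)) (x := 1) h
    (h6.expA c τ) (by simp [hpos])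
  have p2 : ‖phi2 (2 * Complex.I * c ^ 2 * τ)‖ ≤ (τ * c ^ 2)⁻¹ :=
    h.norm_phi2_le_rate 2 (by norm_num) (by push_cast; ring)
  have p2' : ‖phi2 (-2 * Complex.I * c ^ 2 * τ)‖ ≤ (τ * c ^ 2)⁻¹ :=
    h.norm_phi2_le_rate (-2) (by norm_num) (by push_cast; ring)
  have p4 : ‖phi2 (-4 * Complex.I * c ^ 2 * τ)‖ ≤ (τ * c ^ 2)⁻¹ :=
    h.norm_phi2_le_rate (-4) (by norm_num) (by push_cast; ring)
  have prod : ∀ {v w : Fn d}, SobolevBound C s v (M ^ 2) →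
      SobolevBound C s w ((τ * c ^ 2)⁻¹ * (8 * M ^ 3)) →
      SobolevBound C s (v * KleinGordon.opJ c w) ((τ * c ^ 2)⁻¹ * (M ^ 2 * (8 * M ^ 3))) :=
    fun hv hw => (hv.mul hC (hw.opJ hc)).mono (le_of_eq (by ring))
  have e7 := sq_rate_term (a := (τ : ℂ) ^ 2 * (3 * Complex.I / 8) * phase (2 * c ^ 2 * t))
    (x := 3 / 8) h he (by norm_num)
    (prod (hu.sq hC) ((hu.absSq_mul hC).phi2_add p2 (hu.Omega hC h 2 t))) hM5
    (by simp [hpos, mul_comm])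
  have e8 := sq_rate_term (a := (τ : ℂ) ^ 2 * (3 * Complex.I / 8) * phase (-2 * c ^ 2 * t))
    (x := 3 / 8) h he (by norm_num)
    (prod (hu.star.sq hC) ((hu.absSq_mul hC).phi2_add p2' (hu.Omega hC h (-2) t))) hM5
    (by simp [hpos, mul_comm])
  have e9 := sq_rate_term (a := (τ : ℂ) ^ 2 * (6 * Complex.I / 8) * phase (-2 * c ^ 2 * t))
    (x := 6 / 8) h he (by norm_num)
    (prod (hu.absSq hC) ((hu.absSq_mul_star hC).phi2_add p2' (hu.OmegaBar hC h σ (-2) t))) hM5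
    (by simp [hpos, mul_comm])
  have e10 := sq_rate_term (a := (τ : ℂ) ^ 2 * (3 * Complex.I / 8) * phase (-4 * c ^ 2 * t))
    (x := 3 / 8) h he (by norm_num)
    (prod (hu.star.sq hC) ((hu.absSq_mul_star hC).phi2_add p4 (hu.OmegaBar hC h σ (-4) t))) hM5
    (by simp [hpos, mul_comm])
  refine (((((((((e1.add e2).add e3).add e4).add e5).sub e6).sub e7).sub e8).add e9).add e10).mono
    (le_of_eq ?_)
  ring

/-- The hypothesis `hJ` covers both the crude bound `2` for `J_c - 1` without loss (`e = 1`) and the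
bound by `c⁻¹` with loss of derivatives. -/
theorem theta (hC : IsAlgConst d C s) (hC₁ : IsAlgConst d C s₁) (hs : s ≤ s₁)
    (hu : SobolevBound C s₁ u M) (hc : 1 ≤ c)
    (hJ : ∀ (w : Fn d) (A : ℝ), SobolevBound C s₁ w A →
      SobolevBound C s (KleinGordon.opJ c w - w) (2 * e * A)) :
    SobolevBound C s (theta c τ u) (e * (9 / 16 * M ^ 5)) := by
  have hu' := hu.anti hs
  have e1 := (((hJ _ _ (((hu.absSq hC₁).sq hC₁).mul hC₁ hu)).expA c (τ / 2)).smul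
    (a := (1 / 2 * (9 / 64) : ℂ)) (b := 1 / 2 * (9 / 64)) (by norm_num)).neg
  have e2 := ((((hu'.absSq hC).mul hC (hJ _ _ (hu.absSq_mul hC₁))).expA c (τ / 2)).opJ hc).smul
    (a := (1 / 2 * (9 / 32) : ℂ)) (b := 1 / 2 * (9 / 32)) (by norm_num)
  have e3 := ((((hu'.sq hC).mul hC (hJ _ _ (hu.absSq_mul_star hC₁))).expA c (τ / 2)).opJ hc).smul
    (a := (1 / 2 * (9 / 64) : ℂ)) (b := 1 / 2 * (9 / 64)) (by norm_num)
  exact ((e1.sub e2).add e3).mono (le_of_eq (by ring))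

/-- The scheme is the splitting step with `𝒜_c` in place of `-½Δ`, up to an error `O(τe)`. -/
theorem schemeStep_sub (hC : IsAlgConst d C s) (hC₁ : IsAlgConst d C s₁) (hs : s ≤ s₁)
    (hu : SobolevBound C s₁ u M) (h : Unresolved c τ) (σ : ℤ) (t : ℝ) (he : c⁻¹ ≤ e)
    (hJ : ∀ (w : Fn d) (A : ℝ), SobolevBound C s₁ w A →
      SobolevBound C s (KleinGordon.opJ c w - w) (2 * e * A))
    (h2 : SobolevBound C s (KleinGordon.phiRes phi2 c τ (KleinGordon.resBracket c u)) (e / τ * (16 * M ^ 3)))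
    (h4 : SobolevBound C s (KleinGordon.phiNonRes phi2 c τ (-2) (KleinGordon.nonresBracket c u))
      (e / τ * (6 * M ^ 3)))
    (h6 : SobolevBound C s (KleinGordon.phiNonRes phi2 c τ (-4) (KleinGordon.conjBracket c u))
      (e / τ * (6 * M ^ 3))) :
    SobolevBound C s (schemeStep σ c τ t u -
        KleinGordon.expA c (τ / 2) (nonlinFlow τ (KleinGordon.expA c (τ / 2) u)))
      (τ * e * (7 * M ^ 3 + 4 * M ^ 5)) := by
  have hM := hu.nonneg
  have hτ := h.pos
  have hc := h.one_le
  have hc0 := h.c_pos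
  have he0 : 0 ≤ e := le_trans (by positivity) he
  have hu' := hu.anti hs
  have hU := hu.expA c (τ / 2)
  have e1 := (hJ _ _ ((hU.absSq_mul hC₁).expA c (τ / 2))).smul (a := (τ : ℂ) * (3 * Complex.I / 8))
    (b := τ * (3 / 8)) (by simp [abs_of_pos hτ])
  have e2 := (theta (τ := τ) hC hC₁ hs hU hc hJ).smul (a := (τ : ℂ) ^ 2) (b := τ ^ 2) (by simp)
  have hth := hu'.vartheta hC h t
  have e3 : SobolevBound C s (((τ : ℂ) ^ 2 * (3 / 64)) •
      KleinGordon.opJ c (2 * KleinGordon.absSq u * KleinGordon.opJ c (KleinGordon.vartheta c t τ u) -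
        u ^ 2 * KleinGordon.opJ c (star (KleinGordon.vartheta c t τ u))))
      (τ * e * (3 / 64 * (15 * M ^ 5))) := by
    refine sq_rate_term h he (by norm_num) (mono (opJ (((hu'.absSq hC).ofNat_two_mul.mul hC
      (hth.opJ hc)).sub ((hu'.sq hC).mul hC (hth.star.opJ hc))) hc) (le_of_eq (by ring)))
      (by positivity) (by simp [mul_comm])
  have e4 := ((hu'.oscTerm hC h σ t he h2 h4 h6).opJ hc).smul (a := Complex.I / 8) (b := 1 / 8)
    (by simp)
  have hsum := ((e2.sub e1).sub e3).sub e4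
  -- The exact coefficients of `τ e M ^ 3` and `τ e M ^ 5` are `51/8` and `201/64` once `τ ^ 2 ≤ τ`
  -- is used; they are rounded up to `7` and `4`.
  refine SobolevBound.mono (A := _) ?_ (?_ : τ ^ 2 * (e * (9 / 16 * M ^ 5)) +
    τ * (3 / 8) * (2 * e * M ^ 3) + τ * e * (3 / 64 * (15 * M ^ 5)) +
    1 / 8 * (τ * e * (45 * M ^ 3 + 15 * M ^ 5)) ≤ _)
  · convert hsum using 1
    unfold schemeStep
    dsimp only
    abel
  · have h1 : τ ^ 2 * (e * (9 / 16 * M ^ 5)) ≤ τ * e * (9 / 16 * M ^ 5) := by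
      rw [_root_.sq, mul_assoc τ e]
      exact mul_le_mul_of_nonneg_right (mul_le_of_le_one_right hτ.le h.le_one) (by positivity)
    have h3 : 0 ≤ τ * e * M ^ 3 := by positivity
    have h5 : 0 ≤ τ * e * M ^ 5 := by positivity
    nlinarith

/-- Growth of one step of the scheme in a high norm. -/
theorem schemeStep (hC₁ : IsAlgConst d C (s + 1)) (hC₂ : IsAlgConst d C (s + 2))
    (hC : IsAlgConst d C (s + 3)) (h : Unresolved c τ) (hu : SobolevBound C (s + 3) u A)
    (hA : A ≤ M) (σ : ℤ) (t : ℝ) :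
    SobolevBound C (s + 3) (schemeStep σ c τ t u) (A + τ * (7 * M ^ 3 + 4 * M ^ 5 +
      3 / 8 * M ^ 2 * Real.exp (3 / 8 * M ^ 2) * M)) := by
  have huM := hu.mono hA
  have hτ := h.pos
  have hc := h.one_le
  have hc0 := h.c_pos
  have hM := huM.nonneg
  have hcM : c⁻¹ ≤ 1 := inv_le_one_of_one_le₀ hc
  have hs2 : s + 2 + 1 = s + 3 := by ring
  have hs1 : s + 1 + 2 = s + 3 := by ring
  have hu2 : SobolevBound C (s + 2) u M := huM.anti (by linarith)
  have hA1 : SobolevBound C (s + 2) (opA c u) (c * M) := opA_one (by rwa [hs2]) hc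
  have hA2 : SobolevBound C (s + 2) (opA c (star u)) (c * M) :=
    opA_one (by rw [hs2]; exact huM.star) hc
  -- Here `e = 1` and no derivative may be lost. The resonant bracket falls to `H^{s+1}` and regains
  -- two derivatives; the other brackets, of size `c` in `H^{s+2}`, regain one derivative together
  -- with `1/c`.
  have hrest := schemeStep_sub hC hC le_rfl huM h σ t hcM
    (fun w A hw => ((hw.opJ hc).sub hw).mono (by linarith))
    (by
      have := (resBracket hC₁ (by rwa [hs1]) (by rwa [hs1]) hc).phiRes_gain h norm_phi2_mul_le
      rw [hs1] at this
      exact this.mono (le_of_eq (by ring)))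
    (by
      have := (nonresBracket hC₂ hu2 hA1 hA2).phiNonRes_gain h norm_phi2_mul_le le_rfl
      rw [hs2] at this
      exact this.mono (le_of_eq (by field_simp; ring)))
    (by
      have := (conjBracket hC₂ hu2 hA2).phiNonRes_gain h norm_phi2_mul_le (δ := -4) (by norm_num)
      rw [hs2] at this
      exact this.mono (le_of_eq (by field_simp; ring)))
  have hU := hu.expA c (τ / 2)
  have hflow := ((hU.mono hA).nonlinFlow_sub_self hC hτ.le h.le_one).add hU
  rw [sub_add_cancel] at hflow
  have := hrest.add (hflow.expA c (τ / 2))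
  rw [sub_add_cancel] at this
  exact this.mono (le_of_eq (by ring))

/-- The Strang splitting step. -/
def _root_.KleinGordon.strangStep (τ : ℝ) (u : Fn d) : Fn d :=
  KleinGordon.schroedinger (τ / 2) (nonlinFlow τ (KleinGordon.schroedinger (τ / 2) u))

theorem strangStep (hC : IsAlgConst d C s) (hu : SobolevBound C s u A) (hA : A ≤ M) (hτ : 0 ≤ τ)
    (hτ1 : τ ≤ 1) :
    SobolevBound C s (strangStep τ u)
      (A + τ * (3 / 8 * M ^ 2 * Real.exp (3 / 8 * M ^ 2) * M)) := by
  have hU := hu.schroedinger (τ / 2)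
  have hflow := ((hU.mono hA).nonlinFlow_sub_self hC hτ hτ1).add hU
  rw [sub_add_cancel] at hflow
  exact (hflow.schroedinger _).mono (le_of_eq (by ring))

theorem strangStep_sub_strangStep {δ : ℝ} (hC : IsAlgConst d C s) (hu : SobolevBound C s u M)
    (hw : SobolevBound C s w M) (h : SobolevBound C s (u - w) δ) (hτ : 0 ≤ τ) (hτ1 : τ ≤ 1) :
    SobolevBound C s (KleinGordon.strangStep τ u - KleinGordon.strangStep τ w)
      ((1 + τ * flowRate M) * δ) := by
  have hphase : ∀ k : Fin d → ℤ, ‖Complex.exp (Complex.I * (τ / 2 * (normSq k / 2) : ℝ))‖ ≤ 1 :=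
    fun k => (norm_exp_I_mul _).le
  have hU := hu.schroedinger (τ / 2)
  have hW := hw.schroedinger (τ / 2)
  have hUW := fourierMul_sub_map hC.one_le hC.lt hu hw hphase h
  have hflow : ∀ {v : Fn d}, SobolevBound C s v M → SobolevBound C s (nonlinFlow τ v) _ :=
    fun hv => by
      have := (hv.nonlinFlow_sub_self hC hτ hτ1).add hv
      rwa [sub_add_cancel] at this
  exact fourierMul_sub_map hC.one_le hC.lt (hflow hU) (hflow hW) hphase
    (hU.nonlinFlow_sub_nonlinFlow hC hW hUW hτ hτ1)

/-- The constant in the consistency error on the ball of radius `M`. -/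
def _root_.KleinGordon.consistencyConst (M : ℝ) : ℝ :=
  7 * M ^ 3 + 4 * M ^ 5 + (3 / 8 * M ^ 2 * Real.exp (3 / 8 * M ^ 2) * M + M) +
    (1 + flowRate M) * M

/-- Consistency of the scheme with the Strang splitting. -/
theorem schemeStep_sub_strangStep (hC₀ : IsAlgConst d C s) (hC₁ : IsAlgConst d C (s + 1))
    (hC : IsAlgConst d C (s + 3)) (h : Unresolved c τ) (hu : SobolevBound C (s + 3) u M)
    (σ : ℤ) (t : ℝ) :
    SobolevBound C s (KleinGordon.schemeStep σ c τ t u - KleinGordon.strangStep τ u)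
      (τ * c⁻¹ * consistencyConst M) := by
  have hτ := h.pos
  have hc := h.one_le
  have hc0 := h.c_pos
  have hM := hu.nonneg
  have hM3 : 0 ≤ M ^ 3 := by positivity
  have hq := h.rate_le
  have hq0 := h.rate_nonneg
  have hs1 : s + 1 + 2 = s + 3 := by ring
  have hu1 : SobolevBound C (s + 1) u M := hu.anti (by linarith)
  have hu0 : SobolevBound C s u M := hu.anti (by linarith)
  have hA1 : SobolevBound C (s + 1) (opA c u) M := opA_two (by rwa [hs1]) hc
  have hA2 : SobolevBound C (s + 1) (opA c (star u)) M :=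
    opA_two (by rw [hs1]; exact hu.star) hc
  have hdown : ∀ {w : Fn d} {x y : ℝ}, x ≤ y → SobolevBound C (s + 1) w ((τ * c ^ 2)⁻¹ * x) →
      0 ≤ x → SobolevBound C s w (c⁻¹ / τ * y) := fun hxy hw hx =>
    (hw.anti (by linarith)).mono (by gcongr)
  -- Here `e = c⁻¹`. Derivatives are plentiful, so `𝒜_c` is taken of order two and `φ₂` contributes
  -- only its size `(τc²)⁻¹ ≤ c⁻¹ / τ`.
  have hrest := schemeStep_sub hC₀ hC (by linarith) hu h σ t le_rfl
    (fun w A hw => (opJ_sub_self hC₀ (hw.anti (by linarith)) hc).mono (by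
      have := mul_nonneg (inv_nonneg.2 hc0.le) hw.nonneg
      linarith))
    (hdown (by linarith) ((resBracket (M := M) hC₁ (by rwa [hs1]) (by rwa [hs1]) hc).phiRes h
      norm_phi2_mul_le) (by positivity))
    (hdown (by linarith) ((nonresBracket hC₁ hu1 hA1 hA2).phiNonRes h norm_phi2_mul_le le_rfl)
      (by positivity))
    (hdown (by linarith) ((conjBracket hC₁ hu1 hA2).phiNonRes h norm_phi2_mul_le (δ := -4)
      (by norm_num)) (by positivity))
  have hflow : ∀ {s' : ℝ} {v : Fn d}, IsAlgConst d C s' → SobolevBound C s' v M →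
      SobolevBound C s' (nonlinFlow τ v) (3 / 8 * M ^ 2 * Real.exp (3 / 8 * M ^ 2) * M + M) :=
    fun hC' hv => by
      have := (hv.nonlinFlow_sub_self hC' hτ.le h.le_one).add hv
      rw [sub_add_cancel] at this
      refine this.mono ?_
      have h0 : 0 ≤ 3 / 8 * M ^ 2 * Real.exp (3 / 8 * M ^ 2) * M := by positivity
      linarith [mul_le_of_le_one_left h0 h.le_one]
  -- The propagators are exchanged one at a time: `e2` the outer one, acting on a flow still bounded
  -- in `H^{s+3}`, and `e3` the inner one, transported by the Lipschitz bound of the flow.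
  have e2 := (hflow hC (hu.expA c (τ / 2))).expA_sub_schroedinger hC₀ hc (half_pos hτ).le
  have hUV := hu.expA_sub_schroedinger hC₀ hc (half_pos hτ).le
  have hU := hu0.expA c (τ / 2)
  have hV := hu0.schroedinger (τ / 2)
  have e3 := fourierMul_sub_map hC₀.one_le hC₀.lt (hflow hC₀ hU) (hflow hC₀ hV)
    (fun k : Fin d → ℤ => (norm_exp_I_mul (τ / 2 * (normSq k / 2))).le)
    (hU.nonlinFlow_sub_nonlinFlow hC₀ hV hUV hτ.le h.le_one)
  have hsum := (hrest.add e2).add e3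
  rw [sub_add_sub_cancel] at hsum
  have hsum' := hsum
  change SobolevBound C s (_ - KleinGordon.schroedinger _ _ + (KleinGordon.schroedinger _ _ -
    KleinGordon.schroedinger _ _)) _ at hsum'
  rw [sub_add_sub_cancel] at hsum'
  refine hsum'.mono ?_
  have hrate : 0 ≤ flowRate M := by unfold flowRate; positivity
  have h1 : τ / 2 * c⁻¹ ≤ τ * c⁻¹ := by gcongr; linarith
  calc _ ≤ τ * c⁻¹ * (7 * M ^ 3 + 4 * M ^ 5) +
        τ * c⁻¹ * (3 / 8 * M ^ 2 * Real.exp (3 / 8 * M ^ 2) * M + M) +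
        (1 + 1 * flowRate M) * (τ * c⁻¹ * M) := by
        gcongr
        exact h.le_one
    _ = _ := by unfold consistencyConst; ring

end SobolevBound

/-! ### Iteration over the time steps. -/

theorem sobolevNorm_sub_I_smul_le (s : ℝ) (u v : Fn d) :
    sobolevNorm s (u - Complex.I • v) ≤ sobolevNorm s u + sobolevNorm s v := by
  rw [sub_eq_add_neg]
  refine (sobolevNorm_add_le s _ _).trans ?_
  rw [sobolevNorm_neg]
  gcongr
  simpa using sobolevNorm_smul_le s Complex.I v

/-- The growth rate of both schemes on the ball of radius `M`. -/
def growthRate (M : ℝ) : ℝ :=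
  7 * M ^ 3 + 4 * M ^ 5 + 3 / 8 * M ^ 2 * Real.exp (3 / 8 * M ^ 2) * M

namespace SobolevBound

variable {C s A M c τ : ℝ} {u₀ : Fn d}

/-- A bootstrap: up to time `(1 + G)⁻¹` the accumulated growth is at most `1`, so the iterates never
leave the ball of radius `A + 1` on which the one-step bound holds. -/
theorem iterate {f : ℕ → Fn d} {G : ℝ} (hτ : 0 ≤ τ) (hG : 0 ≤ G) (h0 : SobolevBound C s (f 0) A)
    (hstep : ∀ n B, SobolevBound C s (f n) B → B ≤ A + 1 → SobolevBound C s (f (n + 1)) (B + τ * G))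
    (n : ℕ) (hn : n * τ ≤ (1 + G)⁻¹) : SobolevBound C s (f n) (A + 1) := by
  have hle : ∀ m : ℕ, m ≤ n → m * τ * G ≤ 1 := fun m hm => by
    have h1 : (m : ℝ) * τ ≤ (1 + G)⁻¹ := le_trans (by gcongr) hn
    calc _ ≤ (1 + G)⁻¹ * (1 + G) := mul_le_mul h1 (by linarith) hG (by positivity)
      _ = 1 := inv_mul_cancel₀ (by positivity)
  have key : ∀ m : ℕ, m ≤ n → SobolevBound C s (f m) (A + m * τ * G) := fun m => by
    induction m with
    | zero => intro _; simpa using h0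
    | succ m ih =>
      intro hm
      refine (hstep m _ (ih (by omega)) (by linarith [hle m (by omega)])).mono (le_of_eq ?_)
      push_cast; ring
  exact (key n le_rfl).mono (by linarith [hle n le_rfl])

/-- The discrete Gronwall inequality. -/
theorem gronwall {f : ℕ → Fn d} {F E δ : ℝ} (hτ : 0 ≤ τ) (hF : 0 ≤ F) (hE : 0 ≤ E)
    (h0 : SobolevBound C s (f 0) δ) (n : ℕ)
    (hstep : ∀ m < n, ∀ B, SobolevBound C s (f m) B →
      SobolevBound C s (f (m + 1)) (τ * E + (1 + τ * F) * B)) :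
    SobolevBound C s (f n) (Real.exp (F * (n * τ)) * (δ + n * τ * E)) := by
  have hδ := h0.nonneg
  induction n with
  | zero => simpa using h0
  | succ n ih =>
    refine (hstep n (by omega) _ (ih fun m hm => hstep m (by omega))).mono ?_
    have h1 : 1 + τ * F ≤ Real.exp (F * τ) := by linarith [Real.add_one_le_exp (F * τ)]
    have h2 : 1 ≤ Real.exp (F * ((n + 1 : ℕ) * τ)) := Real.one_le_exp (by positivity)
    have h3 : Real.exp (F * ((n + 1 : ℕ) * τ)) = Real.exp (F * τ) * Real.exp (F * (n * τ)) := by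
      rw [← Real.exp_add]; push_cast; ring_nf
    calc _ ≤ Real.exp (F * ((n + 1 : ℕ) * τ)) * (τ * E) +
          Real.exp (F * τ) * (Real.exp (F * (n * τ)) * (δ + n * τ * E)) := by
          exact add_le_add (le_mul_of_one_le_left (by positivity) h2)
            (mul_le_mul_of_nonneg_right h1 (by positivity))
      _ = _ := by rw [h3]; push_cast; ring

end SobolevBound

end KleinGordon

end

/-! ### Conclusion: convergence to the Strang splitting. -/

theorem lemma4p2 (d : ℕ) (hd : 1 ≤ d) (r : ℝ) (hr : (d : ℝ) / 2 < r) (M₃ κ : ℝ≥0)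
    (σ : ℤ) (hσ : σ = 1 ∨ σ = -1) :
    ∃ T : ℝ, 0 < T ∧ ∃ τ₀ : ℝ, 0 < τ₀ ∧ ∃ K : ℝ≥0,
      ∀ c : ℝ, 0 < c →
      ∀ z₀ z₁ φ γ : KleinGordon.Fn d,
        (∀ x, (z₀ x).im = 0) → (∀ x, (z₁ x).im = 0) →
        KleinGordon.sobolevNorm (r + 2) z₁ < ⊤ →
        KleinGordon.sobolevNorm (r + 3) z₀
          + KleinGordon.sobolevNorm (r + 3) (KleinGordon.opJinv c z₁) ≤ (M₃ : ℝ≥0∞) →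
        KleinGordon.sobolevNorm r (z₀ - φ)
          + KleinGordon.sobolevNorm r (KleinGordon.opJinv c z₁ - γ)
            ≤ ENNReal.ofReal ((κ : ℝ) * c⁻¹) →
        ∀ τ : ℝ, 0 < τ → τ ≤ τ₀ → 1 ≤ τ * c →
        ∀ n : ℕ, (n : ℝ) * τ ≤ T →
          KleinGordon.sobolevNorm r
              (KleinGordon.scheme σ c τ z₀ z₁ n - KleinGordon.strang τ φ γ n)
            ≤ ENNReal.ofReal ((K : ℝ) * c⁻¹) := by
  open KleinGordon in
  obtain ⟨C, hC⟩ := exists_isAlgConst hr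
  have hC0 : IsAlgConst d C r := hC r le_rfl (by linarith)
  have hC1 : IsAlgConst d C (r + 1) := hC _ (by linarith) (by linarith)
  have hC2 : IsAlgConst d C (r + 2) := hC _ (by linarith) (by linarith)
  have hC3 : IsAlgConst d C (r + 3) := hC _ (by linarith) le_rfl
  have hCpos : 0 < C := one_pos.trans_le hC0.one_le
  -- `C * M₃` bounds the scheme's datum and `C * (M₃ + κ)` the Strang datum; the extra `1` is the
  -- growth permitted by `iterate`.
  set M : ℝ := C * (M₃ + κ) + 1 with hM
  have hM0 : 0 ≤ M := by positivity
  have hG : 0 ≤ growthRate M := by unfold growthRate; positivity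
  have hF : 0 ≤ flowRate M := by unfold flowRate; positivity
  have hE : 0 ≤ consistencyConst M := by unfold consistencyConst; positivity
  refine ⟨(1 + growthRate M)⁻¹, by positivity, 1, one_pos,
    ⟨Real.exp (flowRate M * (1 + growthRate M)⁻¹) *
      (C * κ + (1 + growthRate M)⁻¹ * consistencyConst M), by positivity⟩, ?_⟩
  intro c hc z₀ z₁ φ γ _ _ _ hz hlim τ hτ hτ1 hτc n hn
  have h : Unresolved c τ := ⟨hτ, hτ1, hτc⟩
  have hcinv : c⁻¹ ≤ 1 := inv_le_one_of_one_le₀ h.one_le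
  set u := scheme σ c τ z₀ z₁ with hu
  set w := strang τ φ γ with hw
  have hu0 : SobolevBound C (r + 3) (u 0) (C * M₃) :=
    .of_sobolevNorm_le M₃.2 hCpos.le <| by
      rw [ENNReal.ofReal_coe_nnreal]
      exact (sobolevNorm_sub_I_smul_le _ _ _).trans hz
  have hd0 : SobolevBound C r (u 0 - w 0) (C * (κ * c⁻¹)) := by
    refine .of_sobolevNorm_le (by positivity) hCpos.le ?_
    have heq : u 0 - w 0 = (z₀ - φ) - Complex.I • (opJinv c z₁ - γ) := by
      simp only [hu, hw, scheme, strang, smul_sub]; abel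
    rw [heq]
    exact (sobolevNorm_sub_I_smul_le _ _ _).trans hlim
  -- No bound on `φ` and `γ` is assumed separately: the Strang datum is the scheme's datum minus
  -- their difference, and `c⁻¹ ≤ 1`.
  have hw0 : SobolevBound C r (w 0) (C * (M₃ + κ)) := by
    have h1 := (hu0.anti (by linarith : r ≤ r + 3)).sub hd0
    rw [sub_sub_cancel] at h1
    refine h1.mono ?_
    have : (κ : ℝ) * c⁻¹ ≤ κ := mul_le_of_le_one_right κ.2 hcinv
    nlinarith
  have hun : ∀ m ≤ n, SobolevBound C (r + 3) (u m) M := fun m hm =>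
    (hu0.mono (by gcongr; simp)).iterate hτ.le hG
      (fun k B hB hBM => SobolevBound.schemeStep hC1 hC2 hC3 h hB hBM σ _) m
      (le_trans (by gcongr) hn)
  have hwn : ∀ m ≤ n, SobolevBound C r (w m) M := fun m hm =>
    hw0.iterate hτ.le hG
      (fun k B hB hBM => (hB.strangStep hC0 hBM hτ.le hτ1).mono (by
        unfold growthRate
        gcongr
        have : 0 ≤ 7 * M ^ 3 + 4 * M ^ 5 := by positivity
        linarith)) m
      (le_trans (by gcongr) hn)
  -- The local error is taken at the scheme's iterate, the only one known in `H^{r+3}`, and is then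
  -- propagated by the Strang step, whose stability needs only `H^r`.
  have herr := SobolevBound.gronwall (f := fun m => u m - w m) (E := c⁻¹ * consistencyConst M)
    hτ.le hF (by positivity) hd0 n fun m hm B hB => by
      have h1 := SobolevBound.schemeStep_sub_strangStep hC0 hC1 hC3 h (hun m hm.le) σ (m * τ)
      have h2 := ((hun m hm.le).anti (by linarith : r ≤ r + 3)).strangStep_sub_strangStep hC0
        (hwn m hm.le) hB hτ.le hτ1
      have h3 := h1.add h2
      rw [sub_add_sub_cancel] at h3
      exact h3.mono (le_of_eq (by ring))
  refine ((herr.mono ?_).sobolevNorm_le hC0.one_le)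
  change _ ≤ Real.exp (flowRate M * (1 + growthRate M)⁻¹) *
    (C * κ + (1 + growthRate M)⁻¹ * consistencyConst M) * c⁻¹
  calc _ = Real.exp (flowRate M * (n * τ)) * (C * κ + n * τ * consistencyConst M) * c⁻¹ := by ring
    _ ≤ _ := by gcongr
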